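/- Work over $\mathbb{C}$. Let $G(2,6)\subset\mathbb{P}(\bigwedge^2\mathbb{C}^6)=\mathbb{P}^{14}$ be the Grassmannian of planes in its Plücker embedding, and let $S_{10}=SO(5,10)\subset\mathbb{P}^{15}$ be the spinor tenfold: the orthogonal Grassmannian (one connected family) of 5-dimensional isotropic subspaces of a 10-dimensional nondegenerate quadratic space, in its spinor embedding, which sends an isotropic subspace $U$ to the line of half-spinors annihilated by $U$ under Clifford multiplication. Let $H\subset\mathbb{P}^{14}$ be a hyperplane such that the hyperplane section $L=G(2,6)\cap H$ has a node (ordinary double point) at a point $o$; that is, in an affine chart of $G(2,6)$ centred at $o$ the local equation of $L$ vanishes at $o$ together with its first derivative and has nondegenerate Hessian there. Let $\pi\colon H\dashrightarrow\mathbb{P}^{12}$ be the projection from $o$, and let $X'\subset\mathbb{P}^{12}$ be the Zariski closure of $\pi(L\setminus\{o\})$, with its reduced structure. Then: 1. $X'$ is a linear section of $S_{10}$: there is a linear embedding $\varphi\colon\mathbb{P}^{12}\hookrightarrow\mathbb{P}^{15}$ that identifies $X'$ with the scheme-theoretic intersection $S_{10}\cap\varphi(\mathbb{P}^{12})$; 2.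 $X'$ contains a smooth 6-dimensional quadric, i.e. a smooth quadric hypersurface in some linear subspace $\mathbb{P}^7\subset\mathbb{P}^{12}$. -/

import Mathlib

open scoped LinearAlgebra.Projectivization

noncomputable section

namespace NodalProjection

/-! ### Projective varieties -/

section Projective

variable {σ τ : Type*}

/-- The affine cone over a set of points of projective space. -/
def cone (Z : Set (ℙ ℂ (σ → ℂ))) : Set (σ → ℂ) :=
  {w | ∃ p ∈ Z, w ∈ p.submodule}

/-- The homogeneous ideal `I(Z)` of all polynomials vanishing on a set `Z` of points of projective
space, i.e. vanishing on the affine cone over `Z`. -/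
def idealOf (Z : Set (ℙ ℂ (σ → ℂ))) : Ideal (MvPolynomial σ ℂ) :=
  MvPolynomial.vanishingIdeal ℂ (cone Z)

/-- The Zariski closure of a set of points of projective space. -/
def zariskiClosure (Z : Set (ℙ ℂ (σ → ℂ))) : Set (ℙ ℂ (σ → ℂ)) :=
  {p | ∀ f ∈ idealOf Z, ∀ w ∈ p.submodule, MvPolynomial.eval w f = 0}

/-- The irrelevant ideal, generated by all the variables. -/
def irrelevant (σ : Type*) : Ideal (MvPolynomial σ ℂ) :=
  Ideal.span (Set.range MvPolynomial.X)

/-- The saturation `⋃ₙ (I : 𝔪ⁿ)` of an ideal with respect to the irrelevant ideal `𝔪`. -/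
def saturation (I : Ideal (MvPolynomial σ ℂ)) : Set (MvPolynomial σ ℂ) :=
  {f | ∃ n : ℕ, ∀ g ∈ irrelevant σ ^ n, g * f ∈ I}

/-- The extension to `ℂ[σ]` of an ideal of `ℂ[τ]`, along the substitution given by a linear map
`φ : ℂ^σ → ℂ^τ`. If `φ` is injective and `J` defines the subscheme `Y ⊆ ℙ(ℂ^τ)`, then the pullback
of `J` defines the scheme-theoretic intersection of `Y` with the linear subspace `ℙ(im φ)`, viewed
inside `ℙ(ℂ^σ) ≅ ℙ(im φ)`. -/
def pullbackIdeal [Fintype σ] [DecidableEq σ] (φ : (σ → ℂ) →ₗ[ℂ] (τ → ℂ))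
    (J : Ideal (MvPolynomial τ ℂ)) : Ideal (MvPolynomial σ ℂ) :=
  J.map (MvPolynomial.aeval fun t : τ =>
    ∑ k : σ, MvPolynomial.C (φ (Pi.single k 1) t) * MvPolynomial.X k :
      MvPolynomial τ ℂ →ₐ[ℂ] MvPolynomial σ ℂ)

/-- The projective variety `X ⊆ ℙ(ℂ^σ)` is a linear section of the projective variety
`Y ⊆ ℙ(ℂ^τ)`: some linear embedding `φ` of `ℙ(ℂ^σ)` into `ℙ(ℂ^τ)` identifies `X` with the
intersection of `Y` with the linear subspace `ℙ(im φ)`, as a set of points and also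
scheme-theoretically (two homogeneous ideals define the same closed subscheme of projective space
if and only if their saturations agree). -/
def IsLinearSectionOf [Fintype σ] [DecidableEq σ]
    (X : Set (ℙ ℂ (σ → ℂ))) (Y : Set (ℙ ℂ (τ → ℂ))) : Prop :=
  ∃ (φ : (σ → ℂ) →ₗ[ℂ] (τ → ℂ)) (hφ : Function.Injective φ),
    X = Projectivization.map φ hφ ⁻¹' Y ∧
    saturation (idealOf X) = saturation (pullbackIdeal φ (idealOf Y))

/-- `X` contains a smooth `d`-dimensional quadric: the zero locus of a nondegenerate quadratic form
on a linear subspace of projective dimension `d + 1`. -/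
def ContainsSmoothQuadric (d : ℕ) (X : Set (ℙ ℂ (σ → ℂ))) : Prop :=
  ∃ (L : Submodule ℂ (σ → ℂ)) (q : QuadraticForm ℂ L),
    Module.finrank ℂ L = d + 2 ∧ q.polarBilin.SeparatingLeft ∧
    ∀ (p : ℙ ℂ (σ → ℂ)) (w : L), p.submodule = ℂ ∙ (w : σ → ℂ) → q w = 0 → p ∈ X

end Projective

/-! ### Hyperplane sections of Grassmannians of planes, nodes and projections -/

section Grassmannian

/-- The decomposable bivector `u ∧ v`. -/
def wedge {n : ℕ} (u v : Fin n → ℂ) : ⋀[ℂ]^2 (Fin n → ℂ) :=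
  exteriorPower.ιMulti ℂ 2 ![u, v]

/-- The Grassmannian `G(2, n)` in its Plücker embedding in `ℙ(⋀² ℂⁿ)`. -/
def grassmannian (n : ℕ) : Set (ℙ ℂ (⋀[ℂ]^2 (Fin n → ℂ))) :=
  {p | ∃ u v : Fin n → ℂ, p.submodule = ℂ ∙ wedge u v}

/-- The section of `G(2, n)` by the hyperplane `ω = 0`. -/
def hyperplaneSection {n : ℕ} (ω : ⋀[ℂ]^2 (Fin n → ℂ) →ₗ[ℂ] ℂ) :
    Set (ℙ ℂ (⋀[ℂ]^2 (Fin n → ℂ))) :=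
  {p ∈ grassmannian n | p.submodule ≤ LinearMap.ker ω}

/-- The hypersurface `f = 0` has a node (ordinary double point) at the origin: `f` and its first
derivative vanish there, and the Hessian is nondegenerate. -/
def HasNodeAtZero {E : Type*} [NormedAddCommGroup E] [NormedSpace ℂ E] (f : E → ℂ) : Prop :=
  f 0 = 0 ∧ fderiv ℂ f 0 = 0 ∧ Function.Injective (fderiv ℂ (fderiv ℂ f) 0)

/-- The section of `G(2, n)` by the hyperplane `ω = 0` has a node at the point `o = [u ∧ v]`.
If `C` is a complement of the plane `⟨u, v⟩`, then `(a, b) ↦ [(u + a) ∧ (v + b)]` is the standard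
affine chart `C × C` of the Grassmannian centred at `o`, in which the section is the hypersurface
`ω ((u + a) ∧ (v + b)) = 0`. -/
def IsNode {n : ℕ} (ω : ⋀[ℂ]^2 (Fin n → ℂ) →ₗ[ℂ] ℂ) (o : ℙ ℂ (⋀[ℂ]^2 (Fin n → ℂ))) : Prop :=
  ∃ (u v : Fin n → ℂ) (C : Submodule ℂ (Fin n → ℂ)),
    o.submodule = ℂ ∙ wedge u v ∧ IsCompl (Submodule.span ℂ {u, v}) C ∧
    HasNodeAtZero fun x : C × C => ω (wedge (u + (x.1 : Fin n → ℂ)) (v + (x.2 : Fin n → ℂ)))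

/-- The closure of the image of the section of `G(2, n)` by the hyperplane `ω = 0` under the
rational map `ℙ(ker ω) ⇢ ℙ(ℂ^σ)` induced by a linear map `π` (a point whose representatives
are killed by `π` has no image). -/
def projectedSection {n : ℕ} {σ : Type*} (ω : ⋀[ℂ]^2 (Fin n → ℂ) →ₗ[ℂ] ℂ)
    (π : LinearMap.ker ω →ₗ[ℂ] (σ → ℂ)) : Set (ℙ ℂ (σ → ℂ)) :=
  zariskiClosure {q | ∃ p ∈ hyperplaneSection ω, ∃ x : LinearMap.ker ω,
    p.submodule = ℂ ∙ (x : ⋀[ℂ]^2 (Fin n → ℂ)) ∧ q.submodule = ℂ ∙ π x}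

end Grassmannian

/-! ### The spinor tenfold -/

section Spinor

/-- The 10-dimensional space `E ⊕ E*` with `E = ℂ⁵`. -/
abbrev V10 : Type := (Fin 5 → ℂ) × (Fin 5 → ℂ)

/-- The nondegenerate quadratic form on `E ⊕ E*`; it defines a smooth 8-dimensional quadric
in `ℙ⁹`. -/
def quad (v : V10) : ℂ := ∑ i, v.1 i * v.2 i

/-- The Clifford action of `E ⊕ E*` on the exterior algebra `⋀ E`, whose basis is indexed by the
subsets of `{0, …, 4}`: `v = (a, b)` acts as exterior multiplication by `a` plus contraction with
`b`. -/
def clifford (v : V10) (s : Finset (Fin 5) → ℂ) : Finset (Fin 5) → ℂ := fun J =>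
  ∑ i : Fin 5, (-1) ^ (J.filter (· < i)).card *
    (if i ∈ J then v.1 i * s (J.erase i) else v.2 i * s (insert i J))

/-- The defining relation of the Clifford algebra: `v · (v · s) = quad v • s`. -/
theorem clifford_clifford (v : V10) (s : Finset (Fin 5) → ℂ) :
    clifford v (clifford v s) = quad v • s := by
  have key : ∀ T : Fin 5 → Fin 5 → ℂ, (∀ i j, i < j → T i j = -T j i) →
      ∑ i, ∑ j, T i j = ∑ i, T i i := by
    intro T hT
    have h01 := hT 0 1 (by decide)
    have h02 := hT 0 2 (by decide)
    have h03 := hT 0 3 (by decide)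
    have h04 := hT 0 4 (by decide)
    have h12 := hT 1 2 (by decide)
    have h13 := hT 1 3 (by decide)
    have h14 := hT 1 4 (by decide)
    have h23 := hT 2 3 (by decide)
    have h24 := hT 2 4 (by decide)
    have h34 := hT 3 4 (by decide)
    simp only [Fin.sum_univ_five]
    linear_combination h01 + h02 + h03 + h04 + h12 + h13 + h14 + h23 + h24 + h34
  have ins : ∀ (i j : Fin 5) (J : Finset (Fin 5)), i ∉ J →
      ((insert i J).filter (· < j)).card = (J.filter (· < j)).card + if i < j then 1 else 0 := by
    decide
  have era : ∀ (i j : Fin 5) (J : Finset (Fin 5)), i ∈ J →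
      (J.filter (· < j)).card = ((J.erase i).filter (· < j)).card + if i < j then 1 else 0 := by
    decide
  funext J
  simp only [clifford, quad, Pi.smul_apply, smul_eq_mul, Finset.sum_mul]
  have expand : ∀ i : Fin 5, (-1 : ℂ) ^ (J.filter (· < i)).card *
      (if i ∈ J then v.1 i * clifford v s (J.erase i) else v.2 i * clifford v s (insert i J)) =
      ∑ j, (-1 : ℂ) ^ (J.filter (· < i)).card * (if i ∈ J then v.1 i *
        ((-1) ^ ((J.erase i).filter (· < j)).card * (if j ∈ J.erase i then
          v.1 j * s ((J.erase i).erase j) else v.2 j * s (insert j (J.erase i))))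
        else v.2 i * ((-1) ^ ((insert i J).filter (· < j)).card * (if j ∈ insert i J then
          v.1 j * s ((insert i J).erase j) else v.2 j * s (insert j (insert i J))))) := by
    intro i
    split_ifs with h <;> simp only [clifford, Finset.mul_sum]
  refine (Finset.sum_congr rfl fun i _ => expand i).trans ((key _ ?_).trans ?_)
  · intro i j hij
    have hne : i ≠ j := hij.ne
    have hji : ¬ j < i := hij.asymm
    by_cases hi : i ∈ J <;> by_cases hj : j ∈ J
    · have e1 := era i j J hi
      have e2 := era j i J hj
      simp only [hij, hji, if_true, if_false, add_zero] at e1 e2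
      simp only [hi, hj, hne, hne.symm, if_true, Finset.mem_erase, ne_eq, not_false_eq_true,
        and_self, e1, e2, Finset.erase_right_comm (a := j) (b := i)]
      ring
    · have e1 := era i j J hi
      have e2 := ins j i J hj
      simp only [hij, hji, if_true, if_false, add_zero] at e1 e2
      have e3 : (insert j J).erase i = insert j (J.erase i) :=
        Finset.erase_insert_of_ne hne.symm
      simp only [hi, hj, hne, hne.symm, if_true, if_false, Finset.mem_erase, Finset.mem_insert,
        ne_eq, not_false_eq_true, and_false, or_true, e1, e2, e3]
      ring
    · have e1 := ins i j J hi
      have e2 := era j i J hj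
      simp only [hij, hji, if_true, if_false, add_zero] at e1 e2
      have e3 : (insert i J).erase j = insert i (J.erase j) := Finset.erase_insert_of_ne hne
      simp only [hi, hj, hne, hne.symm, if_true, if_false, Finset.mem_erase, Finset.mem_insert,
        ne_eq, not_false_eq_true, and_false, or_true, e1, e2, e3]
      ring
    · have e1 := ins i j J hi
      have e2 := ins j i J hj
      simp only [hij, hji, if_true, if_false, add_zero] at e1 e2
      simp only [hi, hj, hne, hne.symm, if_false, Finset.mem_insert, or_self, e1, e2,
        Finset.insert_comm j i]
      ring
  · refine Finset.sum_congr rfl fun i _ => ?_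
    have sq : ∀ k : ℕ, (-1 : ℂ) ^ k * (-1) ^ k = 1 := fun k => by
      rw [← mul_pow]; simp
    by_cases hi : i ∈ J
    · have e1 := era i i J hi
      simp only [lt_irrefl, if_false, add_zero] at e1
      simp only [hi, if_true, Finset.notMem_erase, if_false, Finset.insert_erase hi, ← e1]
      linear_combination (v.1 i * v.2 i * s J) * sq (J.filter (· < i)).card
    · have e1 := ins i i J hi
      simp only [lt_irrefl, if_false, add_zero] at e1
      simp only [hi, if_false, Finset.mem_insert_self, if_true, Finset.erase_insert hi, e1]
      linear_combination (v.1 i * v.2 i * s J) * sq (J.filter (· < i)).card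

/-- The subsets of `{0, …, 4}` of even cardinality. They index a basis of the 16-dimensional
half-spin representation `⋀^even E`. -/
abbrev EvenSubset : Type := {J : Finset (Fin 5) // Even J.card}

/-- The inclusion of the half-spin representation `⋀^even E` in `⋀ E`. -/
def ofEven (s : EvenSubset → ℂ) : Finset (Fin 5) → ℂ := fun J =>
  if h : Even J.card then s ⟨J, h⟩ else 0

/-- The spinor tenfold `S₁₀ = SO(5, 10) ⊆ ℙ¹⁵`: the orthogonal Grassmannian of 5-dimensional
isotropic subspaces `U` of `E ⊕ E*` (i.e. 4-dimensional linear subspaces of the 8-dimensional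
quadric), in its spinor embedding, which sends `U` to the line of half-spinors killed by `U`. The
`U` that kill a nonzero even half-spinor form one of the two families (connected components) of
maximal isotropic subspaces. -/
def spinorTenfold : Set (ℙ ℂ (EvenSubset → ℂ)) :=
  {p | ∃ U : Submodule ℂ V10, Module.finrank ℂ U = 5 ∧ (∀ v ∈ U, quad v = 0) ∧
    ∀ v ∈ U, ∀ s ∈ p.submodule, clifford v (ofEven s) = 0}

end Spinor

end NodalProjection

end

/-! Read `ω` as a skew form on `ℂ⁶`. Near a node `[u ∧ v]` the local equation is `ω(u,v) + ω(a,v) +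
ω(u,b) + ω(a,b)`, so the node condition says that `u` and `v` lie in the radical and that `ω` is
symplectic on the four-dimensional complement `F` (`IsNode.exists_radical`). In an adapted basis the
hyperplane is `p₂₃ + p₄₅ = 0`, and projecting from the node forgets exactly `p₀₁`. The target has
coordinates `(a, b, β)` with `a, b ∈ F` and `β ∈ ⋀²F` of symplectic trace zero. The Plücker
relations give ten quadrics on the image: `β ∧ β = 0`, `a ∧ β = 0`, `b ∧ β = 0`, `ω(a,b) = 0`.
Conversely, a solution with `β ≠ 0` lifts to a decomposable bivector
(`exists_wedge_of_mem_bivectorLocus`).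

On the spinor side, a nonzero even half-spinor is pure exactly when ten quadrics vanish. The even
half-spin space is `⋀^even F ⊕ e₀ ∧ ⋀^odd F`, now with `F = ⟨e₁, …, e₄⟩`. Setting the `⋀⁰` and `⋀⁴`
parts and the trace of the `⋀²` part to zero, and identifying `⋀³F` with `F` by the symplectic form,
leaves the same triples `(a, b, β)`. The ten spinor quadrics then restrict, up to sign, to the ten
quadrics above (`spinorForm_spinorSection`).

For the scheme structure let `Q` be the ideal of the ten quadrics. Then `Q ⊆ pullback of I(S₁₀) ⊆
I(X')`, so it suffices that `I(X')` lies in the saturation of `Q`. This follows once every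
polynomial vanishing on the solutions with `β ≠ 0` is carried into `Q` by a power of each variable.
Inverting a coordinate of `β` other than `w 8` makes the solution set a graph over an affine space.
Inverting a coordinate of `a` or `b` makes it a graph over a hypersurface. Signed symmetries reduce
these charts to two, and `w 8` is handled by the equation `β ∧ β = 0`.

The same argument puts the solutions with `β = 0` in the closure, and there only `ω(a,b) = 0`
remains, which is a smooth quadric in `ℙ⁷`. -/

open scoped LinearAlgebra.Projectivization

noncomputable section

namespace NodalProjection

/-! ### Pure spinors in dimension ten -/

section PureSpinor

/-- The even subsets: the empty set, the pairs in lexicographic order, and the complements of the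
points. -/
def evenList : Fin 16 → EvenSubset :=
  ![⟨∅, by decide⟩, ⟨{0, 1}, by decide⟩, ⟨{0, 2}, by decide⟩, ⟨{0, 3}, by decide⟩,
    ⟨{0, 4}, by decide⟩, ⟨{1, 2}, by decide⟩, ⟨{1, 3}, by decide⟩, ⟨{1, 4}, by decide⟩,
    ⟨{2, 3}, by decide⟩, ⟨{2, 4}, by decide⟩, ⟨{3, 4}, by decide⟩, ⟨{1, 2, 3, 4}, by decide⟩,
    ⟨{0, 2, 3, 4}, by decide⟩, ⟨{0, 1, 3, 4}, by decide⟩, ⟨{0, 1, 2, 4}, by decide⟩,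
    ⟨{0, 1, 2, 3}, by decide⟩]

theorem evenList_bijective : Function.Bijective evenList := by
  constructor
  · decide
  · decide

/-- The numbering of the half-spinor coordinates given by `evenList`. -/
def evenIdx : Fin 16 ≃ EvenSubset := Equiv.ofBijective evenList evenList_bijective

theorem ofEven_apply_of_even (s : EvenSubset → ℂ) {J : Finset (Fin 5)} (h : Even J.card) :
    ofEven s J = s ⟨J, h⟩ := dif_pos h

theorem ofEven_apply_of_not_even (s : EvenSubset → ℂ) {J : Finset (Fin 5)} (h : ¬ Even J.card) :
    ofEven s J = 0 := dif_neg h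

/-- The tables record, for each `i`, the sign exponent, whether `i` belongs to `J`, and the number
of the even subset obtained from `J` by toggling `i`. For a concrete `J` they can be checked by
`decide`, which turns the Clifford action into explicit polynomials. -/
theorem clifford_ofEven_apply (v : V10) (s : EvenSubset → ℂ) (J : Finset (Fin 5)) (n : Fin 5 → ℕ)
    (m : Fin 5 → Bool) (K : Fin 5 → Fin 16)
    (h : ∀ i, (J.filter (· < i)).card = n i ∧ (i ∈ J ↔ m i = true) ∧
      (evenList (K i)).1 = if i ∈ J then J.erase i else insert i J) :
    clifford v (ofEven s) J =
      ∑ i, (-1) ^ n i * ((if m i then v.1 i else v.2 i) * s (evenIdx (K i))) := by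
  refine Finset.sum_congr rfl fun i _ => ?_
  obtain ⟨h1, h2, h3⟩ := h i
  rw [h1]
  congr 1
  by_cases hi : i ∈ J
  · rw [if_pos hi] at h3 ⊢
    rw [if_pos (h2.1 hi), ← h3, ofEven_apply_of_even s (evenList (K i)).2]; rfl
  · rw [if_neg hi] at h3 ⊢
    rw [if_neg (fun hm => hi (h2.2 hm)), ← h3, ofEven_apply_of_even s (evenList (K i)).2]; rfl

theorem clifford_ofEven_of_even (v : V10) (s : EvenSubset → ℂ) {J : Finset (Fin 5)}
    (h : Even J.card) : clifford v (ofEven s) J = 0 := by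
  refine Finset.sum_eq_zero fun i _ => ?_
  by_cases hi : i ∈ J
  · have : ¬ Even (J.erase i).card := by
      revert i J; decide
    rw [if_pos hi, ofEven_apply_of_not_even s this]; simp
  · have : ¬ Even (insert i J).card := by
      revert i J; decide
    rw [if_neg hi, ofEven_apply_of_not_even s this]; simp

theorem clifford_ofEven_0 (v : V10) (s : EvenSubset → ℂ) : clifford v (ofEven s) {0} =
    v.1 0 * s (evenIdx 0) - v.2 1 * s (evenIdx 1) - v.2 2 * s (evenIdx 2) - v.2 3 * s (evenIdx 3)
    - v.2 4 * s (evenIdx 4) :=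
  (clifford_ofEven_apply v s _ ![0, 1, 1, 1, 1] ![true, false, false, false, false]
    ![0, 1, 2, 3, 4] (by decide)).trans
    (by simp only [Fin.sum_univ_five, Matrix.cons_val, if_true, Bool.false_eq_true, if_false]; ring)

theorem clifford_ofEven_1 (v : V10) (s : EvenSubset → ℂ) : clifford v (ofEven s) {1} =
    v.2 0 * s (evenIdx 1) + v.1 1 * s (evenIdx 0) - v.2 2 * s (evenIdx 5) - v.2 3 * s (evenIdx 6)
    - v.2 4 * s (evenIdx 7) :=
  (clifford_ofEven_apply v s _ ![0, 0, 1, 1, 1] ![false, true, false, false, false]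
    ![1, 0, 5, 6, 7] (by decide)).trans
    (by simp only [Fin.sum_univ_five, Matrix.cons_val, if_true, Bool.false_eq_true, if_false]; ring)

theorem clifford_ofEven_2 (v : V10) (s : EvenSubset → ℂ) : clifford v (ofEven s) {2} =
    v.2 0 * s (evenIdx 2) + v.2 1 * s (evenIdx 5) + v.1 2 * s (evenIdx 0) - v.2 3 * s (evenIdx 8)
    - v.2 4 * s (evenIdx 9) :=
  (clifford_ofEven_apply v s _ ![0, 0, 0, 1, 1] ![false, false, true, false, false]
    ![2, 5, 0, 8, 9] (by decide)).trans
    (by simp only [Fin.sum_univ_five, Matrix.cons_val, if_true, Bool.false_eq_true, if_false]; ring)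

theorem clifford_ofEven_3 (v : V10) (s : EvenSubset → ℂ) : clifford v (ofEven s) {3} =
    v.2 0 * s (evenIdx 3) + v.2 1 * s (evenIdx 6) + v.2 2 * s (evenIdx 8) + v.1 3 * s (evenIdx 0)
    - v.2 4 * s (evenIdx 10) :=
  (clifford_ofEven_apply v s _ ![0, 0, 0, 0, 1] ![false, false, false, true, false]
    ![3, 6, 8, 0, 10] (by decide)).trans
    (by simp only [Fin.sum_univ_five, Matrix.cons_val, if_true, Bool.false_eq_true, if_false]; ring)

theorem clifford_ofEven_4 (v : V10) (s : EvenSubset → ℂ) : clifford v (ofEven s) {4} =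
    v.2 0 * s (evenIdx 4) + v.2 1 * s (evenIdx 7) + v.2 2 * s (evenIdx 9) + v.2 3 * s (evenIdx 10)
    + v.1 4 * s (evenIdx 0) :=
  (clifford_ofEven_apply v s _ ![0, 0, 0, 0, 0] ![false, false, false, false, true]
    ![4, 7, 9, 10, 0] (by decide)).trans
    (by simp only [Fin.sum_univ_five, Matrix.cons_val, if_true, Bool.false_eq_true, if_false]; ring)

theorem clifford_ofEven_012 (v : V10) (s : EvenSubset → ℂ) : clifford v (ofEven s) {0,1,2} =
    v.1 0 * s (evenIdx 5) - v.1 1 * s (evenIdx 2) + v.1 2 * s (evenIdx 1) - v.2 3 * s (evenIdx 15)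
    - v.2 4 * s (evenIdx 14) :=
  (clifford_ofEven_apply v s _ ![0, 1, 2, 3, 3] ![true, true, true, false, false]
    ![5, 2, 1, 15, 14] (by decide)).trans
    (by simp only [Fin.sum_univ_five, Matrix.cons_val, if_true, Bool.false_eq_true, if_false]; ring)

theorem clifford_ofEven_013 (v : V10) (s : EvenSubset → ℂ) : clifford v (ofEven s) {0,1,3} =
    v.1 0 * s (evenIdx 6) - v.1 1 * s (evenIdx 3) + v.2 2 * s (evenIdx 15) + v.1 3 * s (evenIdx 1)
    - v.2 4 * s (evenIdx 13) :=
  (clifford_ofEven_apply v s _ ![0, 1, 2, 2, 3] ![true, true, false, true, false]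
    ![6, 3, 15, 1, 13] (by decide)).trans
    (by simp only [Fin.sum_univ_five, Matrix.cons_val, if_true, Bool.false_eq_true, if_false]; ring)

theorem clifford_ofEven_014 (v : V10) (s : EvenSubset → ℂ) : clifford v (ofEven s) {0,1,4} =
    v.1 0 * s (evenIdx 7) - v.1 1 * s (evenIdx 4) + v.2 2 * s (evenIdx 14) + v.2 3 * s (evenIdx
    13) + v.1 4 * s (evenIdx 1) :=
  (clifford_ofEven_apply v s _ ![0, 1, 2, 2, 2] ![true, true, false, false, true]
    ![7, 4, 14, 13, 1] (by decide)).trans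
    (by simp only [Fin.sum_univ_five, Matrix.cons_val, if_true, Bool.false_eq_true, if_false]; ring)

theorem clifford_ofEven_023 (v : V10) (s : EvenSubset → ℂ) : clifford v (ofEven s) {0,2,3} =
    v.1 0 * s (evenIdx 8) - v.2 1 * s (evenIdx 15) - v.1 2 * s (evenIdx 3) + v.1 3 * s (evenIdx 2)
    - v.2 4 * s (evenIdx 12) :=
  (clifford_ofEven_apply v s _ ![0, 1, 1, 2, 3] ![true, false, true, true, false]
    ![8, 15, 3, 2, 12] (by decide)).trans
    (by simp only [Fin.sum_univ_five, Matrix.cons_val, if_true, Bool.false_eq_true, if_false]; ring)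

theorem clifford_ofEven_024 (v : V10) (s : EvenSubset → ℂ) : clifford v (ofEven s) {0,2,4} =
    v.1 0 * s (evenIdx 9) - v.2 1 * s (evenIdx 14) - v.1 2 * s (evenIdx 4) + v.2 3 * s (evenIdx
    12) + v.1 4 * s (evenIdx 2) :=
  (clifford_ofEven_apply v s _ ![0, 1, 1, 2, 2] ![true, false, true, false, true]
    ![9, 14, 4, 12, 2] (by decide)).trans
    (by simp only [Fin.sum_univ_five, Matrix.cons_val, if_true, Bool.false_eq_true, if_false]; ring)

theorem clifford_ofEven_034 (v : V10) (s : EvenSubset → ℂ) : clifford v (ofEven s) {0,3,4} =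
    v.1 0 * s (evenIdx 10) - v.2 1 * s (evenIdx 13) - v.2 2 * s (evenIdx 12) - v.1 3 * s (evenIdx
    4) + v.1 4 * s (evenIdx 3) :=
  (clifford_ofEven_apply v s _ ![0, 1, 1, 1, 2] ![true, false, false, true, true]
    ![10, 13, 12, 4, 3] (by decide)).trans
    (by simp only [Fin.sum_univ_five, Matrix.cons_val, if_true, Bool.false_eq_true, if_false]; ring)

theorem clifford_ofEven_123 (v : V10) (s : EvenSubset → ℂ) : clifford v (ofEven s) {1,2,3} =
    v.2 0 * s (evenIdx 15) + v.1 1 * s (evenIdx 8) - v.1 2 * s (evenIdx 6) + v.1 3 * s (evenIdx 5)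
    - v.2 4 * s (evenIdx 11) :=
  (clifford_ofEven_apply v s _ ![0, 0, 1, 2, 3] ![false, true, true, true, false]
    ![15, 8, 6, 5, 11] (by decide)).trans
    (by simp only [Fin.sum_univ_five, Matrix.cons_val, if_true, Bool.false_eq_true, if_false]; ring)

theorem clifford_ofEven_124 (v : V10) (s : EvenSubset → ℂ) : clifford v (ofEven s) {1,2,4} =
    v.2 0 * s (evenIdx 14) + v.1 1 * s (evenIdx 9) - v.1 2 * s (evenIdx 7) + v.2 3 * s (evenIdx
    11) + v.1 4 * s (evenIdx 5) :=
  (clifford_ofEven_apply v s _ ![0, 0, 1, 2, 2] ![false, true, true, false, true]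
    ![14, 9, 7, 11, 5] (by decide)).trans
    (by simp only [Fin.sum_univ_five, Matrix.cons_val, if_true, Bool.false_eq_true, if_false]; ring)

theorem clifford_ofEven_134 (v : V10) (s : EvenSubset → ℂ) : clifford v (ofEven s) {1,3,4} =
    v.2 0 * s (evenIdx 13) + v.1 1 * s (evenIdx 10) - v.2 2 * s (evenIdx 11) - v.1 3 * s (evenIdx
    7) + v.1 4 * s (evenIdx 6) :=
  (clifford_ofEven_apply v s _ ![0, 0, 1, 1, 2] ![false, true, false, true, true]
    ![13, 10, 11, 7, 6] (by decide)).trans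
    (by simp only [Fin.sum_univ_five, Matrix.cons_val, if_true, Bool.false_eq_true, if_false]; ring)

theorem clifford_ofEven_234 (v : V10) (s : EvenSubset → ℂ) : clifford v (ofEven s) {2,3,4} =
    v.2 0 * s (evenIdx 12) + v.2 1 * s (evenIdx 11) + v.1 2 * s (evenIdx 10) - v.1 3 * s (evenIdx
    9) + v.1 4 * s (evenIdx 8) :=
  (clifford_ofEven_apply v s _ ![0, 0, 0, 1, 2] ![false, false, true, true, true]
    ![12, 11, 10, 9, 8] (by decide)).trans
    (by simp only [Fin.sum_univ_five, Matrix.cons_val, if_true, Bool.false_eq_true, if_false]; ring)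

theorem clifford_ofEven_01234 (v : V10) (s : EvenSubset → ℂ) : clifford v (ofEven s) {0,1,2,3,4} =
    v.1 0 * s (evenIdx 11) - v.1 1 * s (evenIdx 12) + v.1 2 * s (evenIdx 13) - v.1 3 * s (evenIdx
    14) + v.1 4 * s (evenIdx 15) :=
  (clifford_ofEven_apply v s _ ![0, 1, 2, 3, 4] ![true, true, true, true, true]
    ![11, 12, 13, 14, 15] (by decide)).trans
    (by simp only [Fin.sum_univ_five, Matrix.cons_val, if_true]; ring)

theorem even_card_or_eq (J : Finset (Fin 5)) : Even J.card ∨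
    J = {0} ∨ J = {1} ∨ J = {2} ∨ J = {3} ∨ J = {4} ∨ J = {0,1,2} ∨ J = {0,1,3} ∨ J = {0,1,4} ∨ J
    = {0,2,3} ∨ J = {0,2,4} ∨ J = {0,3,4} ∨ J = {1,2,3} ∨ J = {1,2,4} ∨ J = {1,3,4} ∨ J = {2,3,4}
    ∨ J = {0,1,2,3,4} := by
  revert J; decide

/-- The ten quadrics through the spinor tenfold, as a quadratic map from half-spinors to
vectors. -/
def spinorForm {R : Type*} [CommRing R] (s : EvenSubset → R) : (Fin 5 → R) × (Fin 5 → R) :=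
  (![-s (evenIdx 1) * s (evenIdx 12) + s (evenIdx 2) * s (evenIdx 13) - s (evenIdx 3) * s
      (evenIdx 14) + s (evenIdx 4) * s (evenIdx 15),
    -s (evenIdx 1) * s (evenIdx 11) + s (evenIdx 5) * s (evenIdx 13) - s (evenIdx 6) * s
      (evenIdx 14) + s (evenIdx 7) * s (evenIdx 15),
    -s (evenIdx 2) * s (evenIdx 11) + s (evenIdx 5) * s (evenIdx 12) - s (evenIdx 8) * s
      (evenIdx 14) + s (evenIdx 9) * s (evenIdx 15),
    -s (evenIdx 3) * s (evenIdx 11) + s (evenIdx 6) * s (evenIdx 12) - s (evenIdx 8) * s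
      (evenIdx 13) + s (evenIdx 10) * s (evenIdx 15),
    -s (evenIdx 4) * s (evenIdx 11) + s (evenIdx 7) * s (evenIdx 12) - s (evenIdx 9) * s
      (evenIdx 13) + s (evenIdx 10) * s (evenIdx 14)],
  ![s (evenIdx 0) * s (evenIdx 11) - s (evenIdx 5) * s (evenIdx 10) + s (evenIdx 6) * s (evenIdx
      9) - s (evenIdx 7) * s (evenIdx 8),
    -s (evenIdx 0) * s (evenIdx 12) + s (evenIdx 2) * s (evenIdx 10) - s (evenIdx 3) * s
      (evenIdx 9) + s (evenIdx 4) * s (evenIdx 8),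
    s (evenIdx 0) * s (evenIdx 13) - s (evenIdx 1) * s (evenIdx 10) + s (evenIdx 3) * s (evenIdx
      7) - s (evenIdx 4) * s (evenIdx 6),
    -s (evenIdx 0) * s (evenIdx 14) + s (evenIdx 1) * s (evenIdx 9) - s (evenIdx 2) * s (evenIdx
      7) + s (evenIdx 4) * s (evenIdx 5),
    s (evenIdx 0) * s (evenIdx 15) - s (evenIdx 1) * s (evenIdx 8) + s (evenIdx 2) * s (evenIdx
      6) - s (evenIdx 3) * s (evenIdx 5)])

/-- The symmetric bilinear map associated with `spinorForm`. -/
def spinorPolar (s : EvenSubset → ℂ) : (EvenSubset → ℂ) →ₗ[ℂ] V10 where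
  toFun r := spinorForm (s + r) - spinorForm s - spinorForm r
  map_add' r r' := by
    refine Prod.ext ?_ ?_ <;> funext i <;>
      simp only [Prod.fst_sub, Prod.snd_sub, Prod.fst_add, Prod.snd_add,
        Pi.sub_apply, Pi.add_apply] <;>
      fin_cases i <;>
      simp only [spinorForm, Matrix.cons_val, Fin.zero_eta, Fin.mk_one, Fin.reduceFinMk,
        Pi.add_apply] <;>
      ring
  map_smul' c r := by
    refine Prod.ext ?_ ?_ <;> funext i <;>
      simp only [Prod.fst_sub, Prod.snd_sub, Prod.smul_fst, Prod.smul_snd,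
        Pi.sub_apply, Pi.smul_apply, smul_eq_mul, RingHom.id_apply] <;>
      fin_cases i <;>
      simp only [spinorForm, Matrix.cons_val, Fin.zero_eta, Fin.mk_one, Fin.reduceFinMk,
        Pi.add_apply, Pi.smul_apply, smul_eq_mul] <;>
      ring

/-- This is the derivative at `s` in the direction `r` of the cubic identity `spinorForm s · s = 0`.
When `spinorForm s = 0`, it shows that every vector `spinorPolar s r` kills `s`. -/
theorem clifford_spinorPolar (s r : EvenSubset → ℂ) :
    clifford (spinorPolar s r) (ofEven s) + clifford (spinorForm s) (ofEven r) = 0 := by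
  funext J
  rcases even_card_or_eq J with h | rfl | rfl | rfl | rfl | rfl | rfl | rfl | rfl | rfl | rfl | rfl |
    rfl | rfl | rfl | rfl | rfl
  · simp [clifford_ofEven_of_even _ _ h]
  all_goals
    simp only [Pi.add_apply, Pi.zero_apply, clifford_ofEven_0, clifford_ofEven_1,
    clifford_ofEven_2, clifford_ofEven_3, clifford_ofEven_4, clifford_ofEven_012,
    clifford_ofEven_013, clifford_ofEven_014, clifford_ofEven_023, clifford_ofEven_024,
    clifford_ofEven_034, clifford_ofEven_123, clifford_ofEven_124, clifford_ofEven_134,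
    clifford_ofEven_234, clifford_ofEven_01234]
    simp only [spinorPolar, LinearMap.coe_mk, AddHom.coe_mk, Prod.fst_sub, Prod.snd_sub,
      Pi.sub_apply, spinorForm, Matrix.cons_val, Pi.add_apply]
    ring

/-- These are the 2 × 2 minors of the pair `(spinorForm s, u)`, except those pairing a coordinate
with its dual. Each is a combination of the sixteen equations `u · s = 0` with coefficients linear
in `s`. If `spinorForm s ≠ 0`, then `u` is determined by one dual pair of its coordinates, so the
annihilator of `s` has dimension at most two. -/
theorem spinorForm_mul_comm {u : V10} {s : EvenSubset → ℂ} (h : clifford u (ofEven s) = 0) :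
    (∀ i j, (spinorForm s).1 i * u.1 j = (spinorForm s).1 j * u.1 i) ∧
    (∀ i j, (spinorForm s).2 i * u.2 j = (spinorForm s).2 j * u.2 i) ∧
    ∀ i j, i ≠ j → (spinorForm s).1 i * u.2 j = (spinorForm s).2 j * u.1 i := by
  have h0 := (clifford_ofEven_0 u s).symm.trans (congrFun h _)
  have h1 := (clifford_ofEven_1 u s).symm.trans (congrFun h _)
  have h2 := (clifford_ofEven_2 u s).symm.trans (congrFun h _)
  have h3 := (clifford_ofEven_3 u s).symm.trans (congrFun h _)
  have h4 := (clifford_ofEven_4 u s).symm.trans (congrFun h _)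
  have h012 := (clifford_ofEven_012 u s).symm.trans (congrFun h _)
  have h013 := (clifford_ofEven_013 u s).symm.trans (congrFun h _)
  have h014 := (clifford_ofEven_014 u s).symm.trans (congrFun h _)
  have h023 := (clifford_ofEven_023 u s).symm.trans (congrFun h _)
  have h024 := (clifford_ofEven_024 u s).symm.trans (congrFun h _)
  have h034 := (clifford_ofEven_034 u s).symm.trans (congrFun h _)
  have h123 := (clifford_ofEven_123 u s).symm.trans (congrFun h _)
  have h124 := (clifford_ofEven_124 u s).symm.trans (congrFun h _)
  have h134 := (clifford_ofEven_134 u s).symm.trans (congrFun h _)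
  have h234 := (clifford_ofEven_234 u s).symm.trans (congrFun h _)
  have h01234 := (clifford_ofEven_01234 u s).symm.trans (congrFun h _)
  clear h
  simp only [Pi.zero_apply] at *
  have lt : ∀ f : Fin 5 → Fin 5 → Prop, (∀ i, f i i) → (∀ i j, f i j → f j i) → f 0 1 → f 0 2 →
      f 0 3 → f 0 4 → f 1 2 → f 1 3 → f 1 4 → f 2 3 → f 2 4 → f 3 4 → ∀ i j, f i j := by
    intro f h1 h2 _ _ _ _ _ _ _ _ _ _ i j
    fin_cases i <;> fin_cases j <;> first | exact h1 _ | assumption |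
      (refine h2 _ _ ?_; assumption)
  have e1 : ∀ i j, (spinorForm s).1 i * u.1 j = (spinorForm s).1 j * u.1 i := by
    refine lt _ (fun i => rfl) (fun i j h => h.symm) ?_ ?_ ?_ ?_ ?_ ?_ ?_ ?_ ?_ ?_ <;>
      simp only [spinorForm, Matrix.cons_val]
    · linear_combination (s (evenIdx 1)) * h01234 + (-s (evenIdx 15)) * h014 + (s (evenIdx 14))
        * h013 + (-s (evenIdx 13)) * h012
    · linear_combination (s (evenIdx 2)) * h01234 + (-s (evenIdx 15)) * h024 + (s (evenIdx 14))
        * h023 + (-s (evenIdx 12)) * h012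
    · linear_combination (s (evenIdx 3)) * h01234 + (-s (evenIdx 15)) * h034 + (s (evenIdx 13))
        * h023 + (-s (evenIdx 12)) * h013
    · linear_combination (s (evenIdx 4)) * h01234 + (-s (evenIdx 14)) * h034 + (s (evenIdx 13))
        * h024 + (-s (evenIdx 12)) * h014
    · linear_combination (s (evenIdx 5)) * h01234 + (-s (evenIdx 15)) * h124 + (s (evenIdx 14))
        * h123 + (-s (evenIdx 11)) * h012
    · linear_combination (s (evenIdx 6)) * h01234 + (-s (evenIdx 15)) * h134 + (s (evenIdx 13))
        * h123 + (-s (evenIdx 11)) * h013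
    · linear_combination (s (evenIdx 7)) * h01234 + (-s (evenIdx 14)) * h134 + (s (evenIdx 13))
        * h124 + (-s (evenIdx 11)) * h014
    · linear_combination (s (evenIdx 8)) * h01234 + (-s (evenIdx 15)) * h234 + (s (evenIdx 12))
        * h123 + (-s (evenIdx 11)) * h023
    · linear_combination (s (evenIdx 9)) * h01234 + (-s (evenIdx 14)) * h234 + (s (evenIdx 12))
        * h124 + (-s (evenIdx 11)) * h024
    · linear_combination (s (evenIdx 10)) * h01234 + (-s (evenIdx 13)) * h234 + (s (evenIdx 12))
        * h134 + (-s (evenIdx 11)) * h034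
  have e2 : ∀ i j, (spinorForm s).2 i * u.2 j = (spinorForm s).2 j * u.2 i := by
    refine lt _ (fun i => rfl) (fun i j h => h.symm) ?_ ?_ ?_ ?_ ?_ ?_ ?_ ?_ ?_ ?_ <;>
      simp only [spinorForm, Matrix.cons_val]
    · linear_combination (s (evenIdx 0)) * h234 + (-s (evenIdx 8)) * h4 + (s (evenIdx 9)) * h3 +
        (-s (evenIdx 10)) * h2
    · linear_combination (-s (evenIdx 0)) * h134 + (s (evenIdx 6)) * h4 + (-s (evenIdx 7)) * h3
        + (s (evenIdx 10)) * h1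
    · linear_combination (s (evenIdx 0)) * h124 + (-s (evenIdx 5)) * h4 + (s (evenIdx 7)) * h2 +
        (-s (evenIdx 9)) * h1
    · linear_combination (-s (evenIdx 0)) * h123 + (s (evenIdx 5)) * h3 + (-s (evenIdx 6)) * h2
        + (s (evenIdx 8)) * h1
    · linear_combination (s (evenIdx 0)) * h034 + (-s (evenIdx 3)) * h4 + (s (evenIdx 4)) * h3 +
        (-s (evenIdx 10)) * h0
    · linear_combination (-s (evenIdx 0)) * h024 + (s (evenIdx 2)) * h4 + (-s (evenIdx 4)) * h2
        + (s (evenIdx 9)) * h0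
    · linear_combination (s (evenIdx 0)) * h023 + (-s (evenIdx 2)) * h3 + (s (evenIdx 3)) * h2 +
        (-s (evenIdx 8)) * h0
    · linear_combination (s (evenIdx 0)) * h014 + (-s (evenIdx 1)) * h4 + (s (evenIdx 4)) * h1 +
        (-s (evenIdx 7)) * h0
    · linear_combination (-s (evenIdx 0)) * h013 + (s (evenIdx 1)) * h3 + (-s (evenIdx 3)) * h1
        + (s (evenIdx 6)) * h0
    · linear_combination (s (evenIdx 0)) * h012 + (-s (evenIdx 1)) * h2 + (s (evenIdx 2)) * h1 +
        (-s (evenIdx 5)) * h0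
  refine ⟨e1, e2, fun i j hij => ?_⟩
  fin_cases i <;> fin_cases j <;> first | exact absurd rfl hij |
    simp only [spinorForm, Matrix.cons_val, Fin.zero_eta, Fin.mk_one, Fin.reduceFinMk]
  · linear_combination (-s (evenIdx 2)) * h034 + (s (evenIdx 3)) * h024 + (-s (evenIdx 4)) *
      h023 + (s (evenIdx 12)) * h0
  · linear_combination (s (evenIdx 1)) * h034 + (-s (evenIdx 3)) * h014 + (s (evenIdx 4)) * h013
      + (-s (evenIdx 13)) * h0
  · linear_combination (-s (evenIdx 1)) * h024 + (s (evenIdx 2)) * h014 + (-s (evenIdx 4)) *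
      h012 + (s (evenIdx 14)) * h0
  · linear_combination (s (evenIdx 1)) * h023 + (-s (evenIdx 2)) * h013 + (s (evenIdx 3)) * h012
      + (-s (evenIdx 15)) * h0
  · linear_combination (s (evenIdx 5)) * h134 + (-s (evenIdx 6)) * h124 + (s (evenIdx 7)) * h123
      + (-s (evenIdx 11)) * h1
  · linear_combination (s (evenIdx 1)) * h134 + (-s (evenIdx 6)) * h014 + (s (evenIdx 7)) * h013
      + (-s (evenIdx 13)) * h1
  · linear_combination (-s (evenIdx 1)) * h124 + (s (evenIdx 5)) * h014 + (-s (evenIdx 7)) *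
      h012 + (s (evenIdx 14)) * h1
  · linear_combination (s (evenIdx 1)) * h123 + (-s (evenIdx 5)) * h013 + (s (evenIdx 6)) * h012
      + (-s (evenIdx 15)) * h1
  · linear_combination (s (evenIdx 5)) * h234 + (-s (evenIdx 8)) * h124 + (s (evenIdx 9)) * h123
      + (-s (evenIdx 11)) * h2
  · linear_combination (-s (evenIdx 2)) * h234 + (s (evenIdx 8)) * h024 + (-s (evenIdx 9)) *
      h023 + (s (evenIdx 12)) * h2
  · linear_combination (-s (evenIdx 2)) * h124 + (s (evenIdx 5)) * h024 + (-s (evenIdx 9)) *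
      h012 + (s (evenIdx 14)) * h2
  · linear_combination (s (evenIdx 2)) * h123 + (-s (evenIdx 5)) * h023 + (s (evenIdx 8)) * h012
      + (-s (evenIdx 15)) * h2
  · linear_combination (s (evenIdx 6)) * h234 + (-s (evenIdx 8)) * h134 + (s (evenIdx 10)) *
      h123 + (-s (evenIdx 11)) * h3
  · linear_combination (-s (evenIdx 3)) * h234 + (s (evenIdx 8)) * h034 + (-s (evenIdx 10)) *
      h023 + (s (evenIdx 12)) * h3
  · linear_combination (s (evenIdx 3)) * h134 + (-s (evenIdx 6)) * h034 + (s (evenIdx 10)) *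
      h013 + (-s (evenIdx 13)) * h3
  · linear_combination (s (evenIdx 3)) * h123 + (-s (evenIdx 6)) * h023 + (s (evenIdx 8)) * h013
      + (-s (evenIdx 15)) * h3
  · linear_combination (s (evenIdx 7)) * h234 + (-s (evenIdx 9)) * h134 + (s (evenIdx 10)) *
      h124 + (-s (evenIdx 11)) * h4
  · linear_combination (-s (evenIdx 4)) * h234 + (s (evenIdx 9)) * h034 + (-s (evenIdx 10)) *
      h024 + (s (evenIdx 12)) * h4
  · linear_combination (s (evenIdx 4)) * h134 + (-s (evenIdx 7)) * h034 + (s (evenIdx 10)) *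
      h014 + (-s (evenIdx 13)) * h4
  · linear_combination (-s (evenIdx 4)) * h124 + (s (evenIdx 7)) * h024 + (-s (evenIdx 9)) *
      h014 + (s (evenIdx 14)) * h4

/-- If `s (evenIdx k) ≠ 0`, this gives `spinorPolar s` rank at least five. On that chart a maximal
isotropic space is a graph over the coordinate isotropic space killing the basis spinor numbered
`k`. That space is spanned by `e_i` for `i ∈ J` and by the dual vectors for `i ∉ J`, where `J` is
the subset numbered `k`, and `m` is the indicator of `J`. -/
theorem exists_spinorPolar_eq (s : EvenSubset → ℂ) (k : Fin 16) :
    ∃ m : Fin 5 → Bool, ∀ p : Fin 5 → ℂ, ∃ r : EvenSubset → ℂ, ∀ i,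
      (if m i then (spinorPolar s r).1 i else (spinorPolar s r).2 i) = s (evenIdx k) * p i := by
  have key : ∀ m : Fin 5 → Bool, (∀ p : Fin 5 → ℂ, ∃ t : Fin 16 → ℂ,
      ∀ i, (if m i then (spinorPolar s (t ∘ evenIdx.symm)).1 i else
        (spinorPolar s (t ∘ evenIdx.symm)).2 i) = s (evenIdx k) * p i) → ∃ m : Fin 5 → Bool, ∀ p : Fin 5 → ℂ,
      ∃ r : EvenSubset → ℂ, ∀ i, (if m i then (spinorPolar s r).1 i else
        (spinorPolar s r).2 i) = s (evenIdx k) * p i :=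
    fun m h => ⟨m, fun p => let ⟨t, ht⟩ := h p; ⟨_, ht⟩⟩
  -- In each witness, `± p i` sits at the subset obtained from `J` by toggling every element except
  -- `i`. In the selected components of the polar form, the coefficient of that coordinate is `± s
  -- (evenIdx k)`.
  fin_cases k
  on_goal 1 => refine key ![false, false, false, false, false] fun p => ⟨
      ![0, 0, 0, 0, 0, 0, 0, 0, 0, 0, 0, p 0, -p 1, p 2, -p 3, p 4], ?_⟩
  on_goal 2 => refine key ![true, true, false, false, false] fun p => ⟨
      ![0, 0, 0, 0, 0, 0, 0, 0, -p 4, p 3, -p 2, -p 1, -p 0, 0, 0, 0], ?_⟩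
  on_goal 3 => refine key ![true, false, true, false, false] fun p => ⟨
      ![0, 0, 0, 0, 0, 0, p 4, -p 3, 0, 0, p 1, -p 2, 0, p 0, 0, 0], ?_⟩
  on_goal 4 => refine key ![true, false, false, true, false] fun p => ⟨
      ![0, 0, 0, 0, 0, -p 4, 0, p 2, 0, -p 1, 0, -p 3, 0, 0, -p 0, 0], ?_⟩
  on_goal 5 => refine key ![true, false, false, false, true] fun p => ⟨
      ![0, 0, 0, 0, 0, p 3, -p 2, 0, p 1, 0, 0, -p 4, 0, 0, 0, p 0], ?_⟩
  on_goal 6 => refine key ![false, true, true, false, false] fun p => ⟨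
      ![0, 0, 0, -p 4, p 3, 0, 0, 0, 0, 0, -p 0, 0, p 2, p 1, 0, 0], ?_⟩
  on_goal 7 => refine key ![false, true, false, true, false] fun p => ⟨
      ![0, 0, p 4, 0, -p 2, 0, 0, 0, 0, p 0, 0, 0, p 3, 0, -p 1, 0], ?_⟩
  on_goal 8 => refine key ![false, true, false, false, true] fun p => ⟨
      ![0, 0, -p 3, p 2, 0, 0, 0, 0, -p 0, 0, 0, 0, p 4, 0, 0, p 1], ?_⟩
  on_goal 9 => refine key ![false, false, true, true, false] fun p => ⟨
      ![0, -p 4, 0, 0, p 1, 0, 0, -p 0, 0, 0, 0, 0, 0, -p 3, -p 2, 0], ?_⟩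
  on_goal 10 => refine key ![false, false, true, false, true] fun p => ⟨
      ![0, p 3, 0, -p 1, 0, 0, p 0, 0, 0, 0, 0, 0, 0, -p 4, 0, p 2], ?_⟩
  on_goal 11 => refine key ![false, false, false, true, true] fun p => ⟨
      ![0, -p 2, p 1, 0, 0, -p 0, 0, 0, 0, 0, 0, 0, 0, 0, p 4, p 3], ?_⟩
  on_goal 12 => refine key ![false, true, true, true, true] fun p => ⟨
      ![p 0, -p 1, -p 2, -p 3, -p 4, 0, 0, 0, 0, 0, 0, 0, 0, 0, 0, 0], ?_⟩
  on_goal 13 => refine key ![true, false, true, true, true] fun p => ⟨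
      ![-p 1, -p 0, 0, 0, 0, p 2, p 3, p 4, 0, 0, 0, 0, 0, 0, 0, 0], ?_⟩
  on_goal 14 => refine key ![true, true, false, true, true] fun p => ⟨
      ![p 2, 0, p 0, 0, 0, p 1, 0, 0, -p 3, -p 4, 0, 0, 0, 0, 0, 0], ?_⟩
  on_goal 15 => refine key ![true, true, true, false, true] fun p => ⟨
      ![-p 3, 0, 0, -p 0, 0, 0, -p 1, 0, -p 2, 0, p 4, 0, 0, 0, 0, 0], ?_⟩
  on_goal 16 => refine key ![true, true, true, true, false] fun p => ⟨
      ![p 4, 0, 0, 0, p 0, 0, 0, p 1, 0, p 2, p 3, 0, 0, 0, 0, 0], ?_⟩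
  all_goals
    intro i
    fin_cases i <;>
    simp only [spinorPolar, LinearMap.coe_mk, AddHom.coe_mk, Prod.fst_sub, Prod.snd_sub,
      Pi.sub_apply, spinorForm, Matrix.cons_val, Pi.add_apply, Function.comp_apply,
      Equiv.symm_apply_apply, Fin.zero_eta, Fin.mk_one, Fin.reduceFinMk, if_true,
      Bool.false_eq_true, if_false] <;>
    ring

theorem ofEven_eq_zero_iff {s : EvenSubset → ℂ} : ofEven s = 0 ↔ s = 0 := by
  constructor
  · intro h
    funext J
    simpa [ofEven_apply_of_even s J.2] using congrFun h J.1
  · rintro rfl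
    funext J
    simp [ofEven]

/-- The half-spinors on the spinor tenfold satisfy the ten quadratic equations. -/
theorem spinorForm_eq_zero_of_mem {p : ℙ ℂ (EvenSubset → ℂ)} (hp : p ∈ spinorTenfold)
    {s : EvenSubset → ℂ} (hs : s ∈ p.submodule) : spinorForm s = 0 := by
  obtain ⟨U, hU, -, hkill⟩ := hp
  have hcomm : ∀ u ∈ U, _ := fun u hu => spinorForm_mul_comm (hkill u hu s hs)
  -- a nonzero coordinate of `spinorForm s` bounds the dimension of `U` by two
  have bound : ∀ f : V10 →ₗ[ℂ] (Fin 2 → ℂ), (∀ u ∈ U, f u = 0 → u = 0) → False := by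
    intro f hf
    have hinj : Function.Injective (f.domRestrict U) := by
      rw [← LinearMap.ker_eq_bot, LinearMap.ker_eq_bot']
      intro u hu
      exact Subtype.ext (hf u u.2 hu)
    have := LinearMap.finrank_le_finrank_of_injective hinj
    simp [hU] at this
  by_contra hne
  have hcase : (∃ i, (spinorForm s).1 i ≠ 0) ∨ ∃ i, (spinorForm s).2 i ≠ 0 := by
    by_contra! h
    exact hne (Prod.ext (funext h.1) (funext h.2))
  rcases hcase with ⟨i, hi⟩ | ⟨i, hi⟩
  all_goals
    refine bound (LinearMap.pi ![LinearMap.proj i ∘ₗ LinearMap.fst ℂ _ _,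
      LinearMap.proj i ∘ₗ LinearMap.snd ℂ _ _]) fun u hu h => ?_
    have h1 : u.1 i = 0 := congrFun h 0
    have h2 : u.2 i = 0 := congrFun h 1
    obtain ⟨c1, c2, c3⟩ := hcomm u hu
  · have z : ∀ x y : ℂ, (spinorForm s).1 i * x = y * u.1 i → x = 0 := fun x y hxy =>
      (mul_eq_zero.1 (hxy.trans (by rw [h1, mul_zero]))).resolve_left hi
    refine Prod.ext (funext fun j => z _ _ (c1 i j)) (funext fun j => ?_)
    by_cases hij : i = j
    · exact hij ▸ h2
    · exact z _ _ (c3 i j hij)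
  · have z : ∀ x y : ℂ, (spinorForm s).2 i * x = y * u.2 i → x = 0 := fun x y hxy =>
      (mul_eq_zero.1 (hxy.trans (by rw [h2, mul_zero]))).resolve_left hi
    refine Prod.ext (funext fun j => ?_) (funext fun j => z _ _ (c2 i j))
    by_cases hij : j = i
    · exact hij ▸ h1
    · exact z _ _ (c3 j i hij).symm

/-- A half-spinor satisfying the ten quadratic equations is pure. -/
theorem mem_spinorTenfold_of_spinorForm_eq_zero {p : ℙ ℂ (EvenSubset → ℂ)}
    {s : EvenSubset → ℂ} (hp : p.submodule = ℂ ∙ s) (hs : s ≠ 0) (h : spinorForm s = 0) :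
    p ∈ spinorTenfold := by
  have hkill : ∀ r, clifford (spinorPolar s r) (ofEven s) = 0 := by
    intro r
    have := clifford_spinorPolar s r
    rw [h] at this
    rw [← this, left_eq_add]
    funext J
    simp [clifford]
  obtain ⟨k, hk⟩ : ∃ k, s (evenIdx k) ≠ 0 := by
    by_contra! hall
    exact hs (funext fun J => by simpa using hall (evenIdx.symm J))
  obtain ⟨m, hm⟩ := exists_spinorPolar_eq s k
  let g : V10 →ₗ[ℂ] (Fin 5 → ℂ) := LinearMap.pi fun i =>
    if m i then LinearMap.proj i ∘ₗ LinearMap.fst ℂ _ _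
    else LinearMap.proj i ∘ₗ LinearMap.snd ℂ _ _
  have hg : ∀ v i, g v i = if m i then v.1 i else v.2 i := by
    intro v i
    simp only [g, LinearMap.pi_apply]
    split_ifs <;> rfl
  have hsurj : Function.Surjective (g ∘ₗ spinorPolar s) := by
    intro p
    obtain ⟨r, hr⟩ := hm (fun i => (s (evenIdx k))⁻¹ * p i)
    refine ⟨r, funext fun i => ?_⟩
    rw [LinearMap.comp_apply, hg, hr, mul_inv_cancel_left₀ hk]
  -- Restricting `spinorPolar s` to a section of the surjection onto `ℂ⁵` yields a space of vectors
  -- killing `s` of dimension exactly five.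
  obtain ⟨f, hf⟩ := LinearMap.exists_rightInverse_of_surjective _ (LinearMap.range_eq_top.2 hsurj)
  have hinj : Function.Injective (spinorPolar s ∘ₗ f) := by
    intro x y hxy
    have hx := LinearMap.congr_fun hf x
    have hy := LinearMap.congr_fun hf y
    simp only [LinearMap.comp_apply, LinearMap.id_apply] at hx hy hxy
    rw [← hx, ← hy, hxy]
  have hU : ∀ v ∈ LinearMap.range (spinorPolar s ∘ₗ f), clifford v (ofEven s) = 0 := by
    rintro _ ⟨x, rfl⟩
    exact hkill _
  refine ⟨LinearMap.range (spinorPolar s ∘ₗ f), ?_, fun v hv => ?_, fun v hv t ht => ?_⟩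
  · rw [LinearMap.finrank_range_of_inj hinj]
    simp
  -- Isotropy is automatic: `0 = v · (v · s) = quad v • s` with `s ≠ 0`.
  · have hq := clifford_clifford v (ofEven s)
    rw [hU v hv] at hq
    have h0 : clifford v 0 = 0 := by
      funext J
      simp [clifford]
    rw [h0] at hq
    exact (smul_eq_zero.1 hq.symm).resolve_right (mt ofEven_eq_zero_iff.1 hs)
  · rw [hp] at ht
    obtain ⟨c, rfl⟩ := Submodule.mem_span_singleton.1 ht
    have hc : ofEven (c • s) = c • ofEven s := by
      funext J
      by_cases hJ : Even J.card <;> simp [ofEven, hJ]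
    have hcl : clifford v (c • ofEven s) = c • clifford v (ofEven s) := by
      funext J
      simp only [clifford, Pi.smul_apply, smul_eq_mul, Finset.mul_sum]
      refine Finset.sum_congr rfl fun i _ => ?_
      split_ifs <;> ring
    rw [hc, hcl, hU v hv, smul_zero]

end PureSpinor

/-! ### The ideal generated by ten quadrics in thirteen variables -/

section QuadricIdeal

open MvPolynomial

/-- The quadratic equations of the projected section. The coordinates are the components of two
vectors `a = (w 0, …, w 3)`, `b = (w 4, …, w 7)` of a four-dimensional symplectic space, and of a
bivector `β` of symplectic trace zero, `w 8 = β₁₂ = -β₃₄`, `w 9 = β₁₃`, `w 10 = β₁₄`,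
`w 11 = β₂₃`, `w 12 = β₂₄`. The equations are `β ∧ β = 0`, `a ∧ β = 0`, `b ∧ β = 0` and the
orthogonality of `a` and `b`. -/
def quadrics {R : Type*} [CommRing R] (w : Fin 13 → R) : Fin 10 → R :=
  ![w 8 ^ 2 + w 9 * w 12 - w 10 * w 11,
    w 0 * w 11 - w 1 * w 9 + w 2 * w 8,
    w 0 * w 12 - w 1 * w 10 + w 3 * w 8,
    -w 0 * w 8 - w 2 * w 10 + w 3 * w 9,
    -w 1 * w 8 - w 2 * w 12 + w 3 * w 11,
    w 4 * w 11 - w 5 * w 9 + w 6 * w 8,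
    w 4 * w 12 - w 5 * w 10 + w 7 * w 8,
    -w 4 * w 8 - w 6 * w 10 + w 7 * w 9,
    -w 5 * w 8 - w 6 * w 12 + w 7 * w 11,
    w 0 * w 5 - w 1 * w 4 + w 2 * w 7 - w 3 * w 6]

theorem map_quadrics {R S : Type*} [CommRing R] [CommRing S] (f : R →+* S) (w : Fin 13 → R)
    (k : Fin 10) : f (quadrics w k) = quadrics (fun i => f (w i)) k := by
  fin_cases k <;>
    simp only [quadrics, Matrix.cons_val, Fin.zero_eta, Fin.mk_one, Fin.reduceFinMk, map_add,
      map_sub, map_mul, map_neg, map_pow]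

theorem quadrics_smul {R : Type*} [CommRing R] (c : R) (w : Fin 13 → R) (k : Fin 10) :
    quadrics (c • w) k = c ^ 2 * quadrics w k := by
  fin_cases k <;>
    simp only [quadrics, Matrix.cons_val, Fin.zero_eta, Fin.mk_one, Fin.reduceFinMk,
      Pi.smul_apply, smul_eq_mul] <;>
    ring

/-- The ideal generated by the ten quadrics. -/
def quadricIdeal : Ideal (MvPolynomial (Fin 13) ℂ) :=
  Ideal.span (Set.range (quadrics X))

theorem quadrics_mem_quadricIdeal (k : Fin 10) : quadrics X k ∈ quadricIdeal :=
  Ideal.subset_span ⟨k, rfl⟩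

theorem eval_quadrics (w : Fin 13 → ℂ) (k : Fin 10) : eval w (quadrics X k) = quadrics w k := by
  rw [map_quadrics]
  simp only [eval_X]

theorem eval_eq_zero_of_mem_quadricIdeal {f : MvPolynomial (Fin 13) ℂ} (hf : f ∈ quadricIdeal)
    {w : Fin 13 → ℂ} (hw : ∀ k, quadrics w k = 0) : eval w f = 0 := by
  have : quadricIdeal ≤ RingHom.ker (eval w) := by
    rw [quadricIdeal, Ideal.span_le]
    rintro _ ⟨k, rfl⟩
    exact (eval_quadrics w k).trans (hw k)
  exact this hf

variable {σ : Type*}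

/-- Elimination without localizing: if modulo `Q` and after inverting `x` each variable in `S`
becomes an element of `B`, then so does every polynomial in these variables, because the property is
stable under sums and products. -/
theorem exists_pow_mul_sub_mem {Q : Ideal (MvPolynomial σ ℂ)}
    {B : Subalgebra ℂ (MvPolynomial σ ℂ)} {x : MvPolynomial σ ℂ} (hx : x ∈ B) {S : Set σ}
    (h : ∀ i ∈ S, ∃ N : ℕ, ∃ g ∈ B, x ^ N * X i - g ∈ Q) {f : MvPolynomial σ ℂ}
    (hf : f ∈ supported ℂ S) : ∃ N : ℕ, ∃ g ∈ B, x ^ N * f - g ∈ Q := by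
  rw [supported_eq_adjoin_X] at hf
  induction hf using Algebra.adjoin_induction with
  | mem f hf =>
    obtain ⟨i, hi, rfl⟩ := hf
    exact h i hi
  | algebraMap c => exact ⟨0, _, B.algebraMap_mem c, by simp⟩
  | add f f' _ _ h1 h2 =>
    obtain ⟨N, g, hg, h1⟩ := h1
    obtain ⟨M, g', hg', h2⟩ := h2
    refine ⟨N + M, x ^ M * g + x ^ N * g',
      add_mem (mul_mem (pow_mem hx _) hg) (mul_mem (pow_mem hx _) hg'), ?_⟩
    have := add_mem (Q.mul_mem_left (x ^ M) h1) (Q.mul_mem_left (x ^ N) h2)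
    convert this using 1
    ring
  | mul f f' _ _ h1 h2 =>
    obtain ⟨N, g, hg, h1⟩ := h1
    obtain ⟨M, g', hg', h2⟩ := h2
    refine ⟨N + M, g * g', mul_mem hg hg', ?_⟩
    have := add_mem (Q.mul_mem_left (x ^ N * f) h2) (Q.mul_mem_left g' h1)
    convert this using 1
    ring

theorem eval_eq_of_mem_supported {S : Set σ} {g : MvPolynomial σ ℂ} (hg : g ∈ supported ℂ S)
    {w w' : σ → ℂ} (h : ∀ i ∈ S, w i = w' i) : eval w g = eval w' g := by
  have : supported ℂ S ≤ AlgHom.equalizer (aeval w) (aeval w') := by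
    rw [supported_eq_adjoin_X, Algebra.adjoin_le_iff]
    rintro _ ⟨i, hi, rfl⟩
    simpa [AlgHom.mem_equalizer] using h i hi
  simpa [AlgHom.mem_equalizer, aeval_eq_eval] using this hg

/-- Changing coordinates outside `S` does not affect the value of `g`, so the hypothesis makes `x *
g` vanish at every point. Hence it is zero, and `x` can be cancelled. -/
theorem eq_zero_of_mem_supported {S : Set σ} {x g : MvPolynomial σ ℂ} (hx : x ≠ 0)
    (hg : g ∈ supported ℂ S)
    (h : ∀ w, eval w x ≠ 0 → ∃ w', (∀ i ∈ S, w i = w' i) ∧ eval w' g = 0) : g = 0 := by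
  have : x * g = 0 := by
    refine MvPolynomial.funext fun w => ?_
    rw [map_mul, map_zero]
    by_cases hw : eval w x = 0
    · rw [hw, zero_mul]
    · obtain ⟨w', h1, h2⟩ := h w hw
      rw [eval_eq_of_mem_supported hg h1, h2, mul_zero]
  exact (mul_eq_zero.1 this).resolve_left hx

/-- The points of the cone over the projected section at which the bivector component does not
vanish. -/
def bivectorLocus : Set (Fin 13 → ℂ) :=
  {w | (∀ k, quadrics w k = 0) ∧ ∃ i : Fin 13, 9 ≤ i ∧ w i ≠ 0}

/-- Where `w 9 ≠ 0`, the ten equations express `w 1, w 3, w 5, w 7, w 12` through the other eight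
coordinates, which are free. Modulo the quadrics, `X 9 ^ N * f` is therefore a polynomial in the
free variables that vanishes on a dense open set. -/
theorem exists_X_nine_pow_mul_mem {f : MvPolynomial (Fin 13) ℂ}
    (hf : ∀ w ∈ bivectorLocus, eval w f = 0) : ∃ N : ℕ, X 9 ^ N * f ∈ quadricIdeal := by
  let S : Set (Fin 13) := {0, 2, 4, 6, 8, 9, 10, 11}
  have hX : ∀ i ∈ S, (X i : MvPolynomial (Fin 13) ℂ) ∈ supported ℂ S := fun i hi =>
    X_mem_supported.2 hi
  have h0 := hX 0 (by simp [S])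
  have h2 := hX 2 (by simp [S])
  have h4 := hX 4 (by simp [S])
  have h6 := hX 6 (by simp [S])
  have h8 := hX 8 (by simp [S])
  have h9 := hX 9 (by simp [S])
  have h10 := hX 10 (by simp [S])
  have h11 := hX 11 (by simp [S])
  have hQ := quadrics_mem_quadricIdeal
  have elim : ∀ i ∈ (Set.univ : Set (Fin 13)), ∃ N : ℕ, ∃ g ∈ supported ℂ S,
      (X 9 : MvPolynomial (Fin 13) ℂ) ^ N * X i - g ∈ quadricIdeal := by
    intro i _
    by_cases hi : i ∈ S
    · exact ⟨0, X i, hX i hi, by simp⟩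
    have : i = 1 ∨ i = 3 ∨ i = 5 ∨ i = 7 ∨ i = 12 := by
      revert hi; simp only [S, Set.mem_insert_iff, Set.mem_singleton_iff]; revert i; decide
    rcases this with rfl | rfl | rfl | rfl | rfl
    · refine ⟨1, X 0 * X 11 + X 2 * X 8, add_mem (mul_mem h0 h11) (mul_mem h2 h8), ?_⟩
      convert neg_mem (hQ 1) using 1
      simp only [quadrics, Matrix.cons_val]
      ring
    · refine ⟨1, X 0 * X 8 + X 2 * X 10, add_mem (mul_mem h0 h8) (mul_mem h2 h10), ?_⟩
      convert hQ 3 using 1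
      simp only [quadrics, Matrix.cons_val]
      ring
    · refine ⟨1, X 4 * X 11 + X 6 * X 8, add_mem (mul_mem h4 h11) (mul_mem h6 h8), ?_⟩
      convert neg_mem (hQ 5) using 1
      simp only [quadrics, Matrix.cons_val]
      ring
    · refine ⟨1, X 4 * X 8 + X 6 * X 10, add_mem (mul_mem h4 h8) (mul_mem h6 h10), ?_⟩
      convert hQ 7 using 1
      simp only [quadrics, Matrix.cons_val]
      ring
    · refine ⟨1, X 10 * X 11 - X 8 ^ 2, sub_mem (mul_mem h10 h11) (pow_mem h8 2), ?_⟩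
      convert hQ 0 using 1
      simp only [quadrics, Matrix.cons_val]
      ring
  obtain ⟨N, g, hg, hN⟩ := exists_pow_mul_sub_mem h9 elim
    (f := f) (by rw [supported_univ]; exact Algebra.mem_top)
  have hg0 : g = 0 := by
    refine eq_zero_of_mem_supported (X_ne_zero 9) hg fun w hw => ?_
    rw [eval_X] at hw
    -- The point of the graph over the free coordinates of `w`.
    let w' : Fin 13 → ℂ := ![w 0, (w 0 * w 11 + w 2 * w 8) / w 9, w 2,
      (w 0 * w 8 + w 2 * w 10) / w 9, w 4, (w 4 * w 11 + w 6 * w 8) / w 9, w 6,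
      (w 4 * w 8 + w 6 * w 10) / w 9, w 8, w 9, w 10, w 11, (w 10 * w 11 - w 8 ^ 2) / w 9]
    have hw' : ∀ k, quadrics w' k = 0 := by
      intro k
      fin_cases k <;>
        simp only [quadrics, w', Matrix.cons_val, Fin.zero_eta, Fin.mk_one, Fin.reduceFinMk] <;>
        field_simp <;> ring
    refine ⟨w', ?_, ?_⟩
    · simp [S, w']
    · have h1 := eval_eq_zero_of_mem_quadricIdeal hN hw'
      rw [map_sub, map_mul, hf w' ⟨hw', 9, le_rfl, hw⟩, mul_zero, zero_sub, neg_eq_zero] at h1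
      exact h1
  rw [hg0, sub_zero] at hN
  exact ⟨N, hN⟩

/-- Where `w 0 ≠ 0`, the coordinates `w 5, w 8, w 11, w 12` can be eliminated, and the other nine
satisfy a single equation `h = 0`. This chart also contains points with `β = 0`, where `f` is not
assumed to vanish. Eliminating `X 7` requires inverting `X 9` as well, and that factor is removed
afterwards because `X 9` is prime and does not divide `h`. -/
theorem exists_X_zero_pow_mul_mem {f : MvPolynomial (Fin 13) ℂ}
    (hf : ∀ w ∈ bivectorLocus, eval w f = 0) : ∃ N : ℕ, X 0 ^ N * f ∈ quadricIdeal := by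
  let S : Set (Fin 13) := {0, 1, 2, 3, 4, 6, 9, 10}
  let S' : Set (Fin 13) := insert 7 S
  have hX : ∀ i ∈ S, (X i : MvPolynomial (Fin 13) ℂ) ∈ supported ℂ S := fun i hi =>
    X_mem_supported.2 hi
  have hSS' : supported ℂ S ≤ supported ℂ S' := supported_mono (Set.subset_insert _ _)
  have h0 := hX 0 (by simp [S])
  have h1 := hX 1 (by simp [S])
  have h2 := hX 2 (by simp [S])
  have h3 := hX 3 (by simp [S])
  have h4 := hX 4 (by simp [S])
  have h6 := hX 6 (by simp [S])
  have h9 := hX 9 (by simp [S])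
  have h10 := hX 10 (by simp [S])
  have h7 : (X 7 : MvPolynomial (Fin 13) ℂ) ∈ supported ℂ S' :=
    X_mem_supported.2 (Set.mem_insert _ _)
  have hQ := quadrics_mem_quadricIdeal
  have elim : ∀ i ∈ (Set.univ : Set (Fin 13)), ∃ N : ℕ, ∃ g ∈ supported ℂ S',
      (X 0 : MvPolynomial (Fin 13) ℂ) ^ N * X i - g ∈ quadricIdeal := by
    intro i _
    by_cases hi : i ∈ S'
    · exact ⟨0, X i, X_mem_supported.2 hi, by simp⟩
    have : i = 5 ∨ i = 8 ∨ i = 11 ∨ i = 12 := by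
      revert hi; simp only [S, S', Set.mem_insert_iff, Set.mem_singleton_iff]; revert i; decide
    rcases this with rfl | rfl | rfl | rfl
    · refine ⟨1, X 1 * X 4 - X 2 * X 7 + X 3 * X 6,
        add_mem (sub_mem (hSS' (mul_mem h1 h4)) (mul_mem (hSS' h2) h7))
          (hSS' (mul_mem h3 h6)), ?_⟩
      convert hQ 9 using 1
      simp only [quadrics, Matrix.cons_val]
      ring
    · refine ⟨1, X 3 * X 9 - X 2 * X 10, hSS' (sub_mem (mul_mem h3 h9) (mul_mem h2 h10)), ?_⟩
      convert neg_mem (hQ 3) using 1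
      simp only [quadrics, Matrix.cons_val]
      ring
    · refine ⟨2, X 0 * X 1 * X 9 - X 2 * (X 3 * X 9 - X 2 * X 10),
        hSS' (sub_mem (mul_mem (mul_mem h0 h1) h9)
          (mul_mem h2 (sub_mem (mul_mem h3 h9) (mul_mem h2 h10)))), ?_⟩
      convert add_mem (Ideal.mul_mem_left _ (X 0) (hQ 1)) (Ideal.mul_mem_left _ (X 2) (hQ 3))
        using 1
      simp only [quadrics, Matrix.cons_val]
      ring
    · refine ⟨2, X 0 * X 1 * X 10 - X 3 * (X 3 * X 9 - X 2 * X 10),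
        hSS' (sub_mem (mul_mem (mul_mem h0 h1) h10)
          (mul_mem h3 (sub_mem (mul_mem h3 h9) (mul_mem h2 h10)))), ?_⟩
      convert add_mem (Ideal.mul_mem_left _ (X 0) (hQ 2)) (Ideal.mul_mem_left _ (X 3) (hQ 3))
        using 1
      simp only [quadrics, Matrix.cons_val]
      ring
  obtain ⟨M, g, hg, hM⟩ := exists_pow_mul_sub_mem (hSS' h0) elim
    (f := f) (by rw [supported_univ]; exact Algebra.mem_top)
  -- The combination of quadrics 3 and 7 from which `X 8` cancels.
  let h : MvPolynomial (Fin 13) ℂ :=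
    X 9 * (X 0 * X 7 - X 3 * X 4) - X 10 * (X 0 * X 6 - X 2 * X 4)
  have hh : h ∈ quadricIdeal := by
    convert sub_mem (Ideal.mul_mem_left _ (X 0) (hQ 7)) (Ideal.mul_mem_left _ (X 4) (hQ 3)) using 1
    simp only [h, quadrics, Matrix.cons_val]
    ring
  have hX9h : ¬ X 9 ∣ h := by
    rintro ⟨q, hq⟩
    -- A point with `X 9 = 0` at which `h = -1`.
    have := congrArg (eval ![1, 0, 0, 0, 0, 0, 1, 0, 0, 0, 1, 0, 0]) hq
    simp [h] at this
  have elim' : ∀ i ∈ S', ∃ N : ℕ, ∃ g ∈ supported ℂ S,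
      (X 0 * X 9 : MvPolynomial (Fin 13) ℂ) ^ N * X i - g ∈ Ideal.span {h} := by
    rintro i (rfl | hi)
    · refine ⟨1, X 9 * (X 3 * X 4) + X 10 * (X 0 * X 6 - X 2 * X 4),
        add_mem (mul_mem h9 (mul_mem h3 h4))
          (mul_mem h10 (sub_mem (mul_mem h0 h6) (mul_mem h2 h4))), ?_⟩
      convert Ideal.mem_span_singleton_self h using 1
      simp only [h]
      ring
    · exact ⟨0, X i, hX i hi, by simp⟩
  obtain ⟨K, g', hg', hK⟩ := exists_pow_mul_sub_mem (mul_mem h0 h9) elim' hg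
  have hg0 : g' = 0 := by
    refine eq_zero_of_mem_supported (mul_ne_zero (X_ne_zero 0) (X_ne_zero 9)) hg' fun w hw => ?_
    rw [map_mul, eval_X, eval_X, mul_ne_zero_iff] at hw
    obtain ⟨hw0, hw9⟩ := hw
    let v7 := (w 9 * (w 3 * w 4) + w 10 * (w 0 * w 6 - w 2 * w 4)) / (w 0 * w 9)
    let v8 := (w 3 * w 9 - w 2 * w 10) / w 0
    let w' : Fin 13 → ℂ := ![w 0, w 1, w 2, w 3, w 4,
      (w 1 * w 4 - w 2 * v7 + w 3 * w 6) / w 0, w 6, v7, v8, w 9, w 10,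
      (w 1 * w 9 - w 2 * v8) / w 0, (w 1 * w 10 - w 3 * v8) / w 0]
    have hw' : ∀ k, quadrics w' k = 0 := by
      intro k
      fin_cases k <;>
        simp only [quadrics, w', v7, v8, Matrix.cons_val, Fin.zero_eta, Fin.mk_one,
          Fin.reduceFinMk] <;>
        field_simp <;> ring
    refine ⟨w', ?_, ?_⟩
    · simp [S, w']
    · have e1 := eval_eq_zero_of_mem_quadricIdeal hM hw'
      rw [map_sub, map_mul, hf w' ⟨hw', 9, le_rfl, hw9⟩, mul_zero, zero_sub, neg_eq_zero] at e1
      have e2 := eval_eq_zero_of_mem_quadricIdeal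
        ((Ideal.span_singleton_le_iff_mem _).2 hh hK) hw'
      rw [map_sub, map_mul, e1, mul_zero, zero_sub, neg_eq_zero] at e2
      exact e2
  rw [hg0, sub_zero, Ideal.mem_span_singleton] at hK
  obtain ⟨k, hk⟩ := hK
  rw [mul_pow, mul_comm (X 0 ^ K), mul_assoc] at hk
  -- From `X 9 ^ K ∣ h * k` and `X 9 ∤ h`, the whole power divides the cofactor `k`.
  obtain ⟨k', rfl⟩ := X_prime.pow_dvd_of_dvd_mul_left K hX9h ⟨_, hk.symm⟩
  have hk' : X 0 ^ K * g = h * k' :=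
    mul_left_cancel₀ (pow_ne_zero K (X_ne_zero 9)) (hk.trans (by ring))
  refine ⟨K + M, ?_⟩
  have := add_mem (Ideal.mul_mem_left _ (X 0 ^ K) hM) (Ideal.mul_mem_right k' _ hh)
  rw [← hk'] at this
  convert this using 1
  ring

/-- If a signed involution of the variables preserves the quadrics and the locus of nonzero
bivectors, then a power of the image of a variable can be used to move the vanishing ideal into
the quadric ideal as soon as a power of that variable can. -/
theorem exists_pow_mul_mem_of_involution (ε : Fin 13 → ℂ) (ρ : Fin 13 → Fin 13)
    (hρ : ∀ i, ρ (ρ i) = i) (hε : ∀ i, ε i * ε (ρ i) = 1) (h9 : ∀ i, 9 ≤ i → 9 ≤ ρ i)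
    (hQ : ∀ k, quadrics (fun i => C (ε i) * X (ρ i)) k ∈ quadricIdeal) (i : Fin 13)
    (hi : ∀ f : MvPolynomial (Fin 13) ℂ, (∀ w ∈ bivectorLocus, eval w f = 0) →
      ∃ N : ℕ, X i ^ N * f ∈ quadricIdeal)
    (f : MvPolynomial (Fin 13) ℂ) (hf : ∀ w ∈ bivectorLocus, eval w f = 0) :
    ∃ N : ℕ, X (ρ i) ^ N * f ∈ quadricIdeal := by
  let T : MvPolynomial (Fin 13) ℂ →ₐ[ℂ] MvPolynomial (Fin 13) ℂ :=
    aeval fun i => C (ε i) * X (ρ i)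
  have hT : ∀ i, T (X i) = C (ε i) * X (ρ i) := fun i => aeval_X _ i
  have hTT : ∀ f, T (T f) = f := by
    intro f
    have : T.comp T = AlgHom.id ℂ _ := by
      refine MvPolynomial.algHom_ext fun i => ?_
      rw [AlgHom.comp_apply, hT, map_mul, hT, hρ, ← algebraMap_eq, AlgHom.commutes, ← mul_assoc,
        ← map_mul, hε, map_one, one_mul, AlgHom.id_apply]
    exact DFunLike.congr_fun this f
  have hev : ∀ (w : Fin 13 → ℂ) f, eval w (T f) = eval (fun i => ε i * w (ρ i)) f := by
    intro w f
    have : (aeval w).comp T = (aeval fun i => ε i * w (ρ i) : _ →ₐ[ℂ] ℂ) := by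
      refine MvPolynomial.algHom_ext fun i => ?_
      simp [hT]
    simpa [aeval_eq_eval] using DFunLike.congr_fun this f
  have hTQ : ∀ f ∈ quadricIdeal, T f ∈ quadricIdeal := by
    have : quadricIdeal ≤ quadricIdeal.comap T := by
      conv_lhs => rw [quadricIdeal]
      rw [Ideal.span_le]
      rintro _ ⟨k, rfl⟩
      have e := map_quadrics T.toRingHom X k
      simp only [AlgHom.toRingHom_eq_coe, RingHom.coe_coe, hT] at e
      simpa [e] using hQ k
    exact fun f hf => this hf
  obtain ⟨N, hN⟩ := hi (T f) fun w hw => by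
    rw [hev]
    refine hf _ ⟨fun k => ?_, ?_⟩
    · have := eval_eq_zero_of_mem_quadricIdeal (hTQ _ (quadrics_mem_quadricIdeal k)) hw.1
      rwa [hev, eval_quadrics] at this
    · obtain ⟨j, hj, hwj⟩ := hw.2
      refine ⟨ρ j, h9 j hj, ?_⟩
      change ε (ρ j) * w (ρ (ρ j)) ≠ 0
      rw [hρ]
      exact mul_ne_zero (right_ne_zero_of_mul_eq_one (hε j)) hwj
  have := hTQ _ hN
  rw [map_mul, hTT, map_pow, hT] at this
  refine ⟨N, ?_⟩
  convert Ideal.mul_mem_left _ (C (ε (ρ i)) ^ N) this using 1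
  rw [← mul_assoc, ← mul_pow, ← mul_assoc, ← C_mul, mul_comm (ε _), hε, C_1, one_mul]

/-- Symmetries of the symplectic space carry `X 0` to all coordinates of `a` and `b`, and `X 9` to
those of `β` other than `X 8`. The variable `X 8` is fixed by the symmetries used and has to be
treated separately. -/
theorem exists_X_pow_mul_mem {f : MvPolynomial (Fin 13) ℂ}
    (hf : ∀ w ∈ bivectorLocus, eval w f = 0) (i : Fin 13) (hi : i ≠ 8) :
    ∃ N : ℕ, X i ^ N * f ∈ quadricIdeal := by
  let P : Fin 13 → Prop := fun i => ∀ f : MvPolynomial (Fin 13) ℂ,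
    (∀ w ∈ bivectorLocus, eval w f = 0) → ∃ N : ℕ, X i ^ N * f ∈ quadricIdeal
  have p0 : P 0 := fun f hf => exists_X_zero_pow_mul_mem hf
  have p9 : P 9 := fun f hf => exists_X_nine_pow_mul_mem hf
  have hQ := quadrics_mem_quadricIdeal
  -- exchange of `a` and `b`
  have swap : ∀ i, P i → P ((![4, 5, 6, 7, 0, 1, 2, 3, 8, 9, 10, 11, 12] : Fin 13 → Fin 13) i) := by
    refine exists_pow_mul_mem_of_involution (fun _ => 1)
      ![4, 5, 6, 7, 0, 1, 2, 3, 8, 9, 10, 11, 12] (by decide) (by simp) (by decide) fun k => ?_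
    -- The table gives the quadric onto which the substitution carries the `k`-th one. The unit
    -- inserted next supplies the sign, here only for the antisymmetric pairing of `a` and `b`.
    have := hQ ((![0, 5, 6, 7, 8, 1, 2, 3, 4, 9] : Fin 10 → Fin 10) k)
    rw [← Ideal.unit_mul_mem_iff_mem _ (isUnit_one.neg.pow (if k = 9 then 1 else 0))] at this
    convert this using 1
    fin_cases k <;> simp [quadrics]
    ring
  -- exchange of the first and the second hyperbolic plane
  have planes : ∀ i, P i →
      P ((![2, 3, 0, 1, 6, 7, 4, 5, 8, 9, 11, 10, 12] : Fin 13 → Fin 13) i) := by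
    refine exists_pow_mul_mem_of_involution ![1, 1, 1, 1, 1, 1, 1, 1, -1, -1, -1, -1, -1]
      ![2, 3, 0, 1, 6, 7, 4, 5, 8, 9, 11, 10, 12] (by decide) (fun i => ?_) (by decide)
      fun k => ?_
    · fin_cases i <;> simp
    have := hQ ((![0, 3, 4, 1, 2, 7, 8, 5, 6, 9] : Fin 10 → Fin 10) k)
    convert this using 1
    fin_cases k <;>
      simp [quadrics] <;> ring
  -- exchange of the basis vectors of the second hyperbolic plane
  have vectors : ∀ i, P i →
      P ((![0, 1, 3, 2, 4, 5, 7, 6, 8, 10, 9, 12, 11] : Fin 13 → Fin 13) i) := by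
    refine exists_pow_mul_mem_of_involution ![1, -1, 1, 1, 1, -1, 1, 1, -1, 1, 1, -1, -1]
      ![0, 1, 3, 2, 4, 5, 7, 6, 8, 10, 9, 12, 11] (by decide) (fun i => ?_) (by decide)
      fun k => ?_
    · fin_cases i <;> simp
    have := hQ ((![0, 2, 1, 3, 4, 6, 5, 7, 8, 9] : Fin 10 → Fin 10) k)
    rw [← Ideal.unit_mul_mem_iff_mem _
      (isUnit_one.neg.pow (if k = 0 ∨ k = 4 ∨ k = 8 then 0 else 1))] at this
    convert this using 1
    fin_cases k <;>
      simp [quadrics] <;> ring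
  have p2 : P 2 := planes 0 p0
  have p3 : P 3 := vectors 2 p2
  have p1 : P 1 := planes 3 p3
  have p10 : P 10 := vectors 9 p9
  have p11 : P 11 := planes 10 p10
  have p12 : P 12 := vectors 11 p11
  have : P i := by
    fin_cases i
    exacts [p0, p1, p2, p3, swap 0 p0, swap 1 p1, swap 2 p2, swap 3 p3, absurd rfl hi, p9, p10,
      p11, p12]
  exact this f hf

theorem X_mem_irrelevant {σ : Type*} (i : σ) : X i ∈ irrelevant σ :=
  Ideal.subset_span ⟨i, rfl⟩

/-- For `i ≠ 8` a power of `X i` carries `f` into the quadric ideal. For `X 8` the equation `β ∧ β =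
0` writes `X 8 ^ 2`, modulo the quadrics, through products of the other coordinates of `β`. -/
theorem irrelevant_le_radical_colon {f : MvPolynomial (Fin 13) ℂ} {n : ℕ}
    (hf : ∀ g ∈ irrelevant (Fin 13) ^ n, ∀ w ∈ bivectorLocus, eval w (g * f) = 0) :
    irrelevant (Fin 13) ≤ (quadricIdeal.colon {f}).radical := by
  have hX : ∀ i : Fin 13, i ≠ 8 → X i ∈ (quadricIdeal.colon {f}).radical := by
    intro i hi
    obtain ⟨N, hN⟩ := exists_X_pow_mul_mem
      (hf _ (Ideal.pow_mem_pow (X_mem_irrelevant i) n)) i hi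
    refine ⟨N + n, ?_⟩
    rw [Submodule.mem_colon_singleton, pow_add, smul_eq_mul, mul_assoc]
    exact hN
  rw [irrelevant, Ideal.span_le]
  rintro _ ⟨i, rfl⟩
  by_cases hi : i = 8
  · subst hi
    have h0 : quadrics X 0 ∈ (quadricIdeal.colon {f}).radical :=
      Ideal.le_radical (Ideal.le_colon (quadrics_mem_quadricIdeal 0))
    have h1 := Ideal.mul_mem_right (X 12) _ (hX 9 (by decide))
    have h2 := Ideal.mul_mem_right (X 11) _ (hX 10 (by decide))
    have h3 := add_mem (sub_mem h0 h1) h2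
    have : (X 8 : MvPolynomial (Fin 13) ℂ) ^ 2 ∈ (quadricIdeal.colon {f}).radical := by
      convert h3 using 1
      simp only [quadrics, Matrix.cons_val]
      ring
    exact Ideal.mem_radical_of_pow_mem this
  · exact hX i hi

/-- The irrelevant ideal is finitely generated, so lying in the radical of the colon ideal puts some
power of it in the colon ideal itself. The exponent `n` admits any `f` in the saturation of a
vanishing ideal; `n = 0` is the case of `f` vanishing on the locus. -/
theorem mem_saturation_quadricIdeal {f : MvPolynomial (Fin 13) ℂ} {n : ℕ}
    (hf : ∀ g ∈ irrelevant (Fin 13) ^ n, ∀ w ∈ bivectorLocus, eval w (g * f) = 0) :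
    f ∈ saturation quadricIdeal := by
  obtain ⟨N, hN⟩ := Ideal.exists_pow_le_of_le_radical_of_fg (irrelevant_le_radical_colon hf)
    (IsNoetherian.noetherian _)
  exact ⟨N, fun g hg => by simpa using hN hg⟩

end QuadricIdeal

/-! ### Linear substitutions -/

section Substitution

open MvPolynomial

variable {σ τ υ : Type*}

theorem mem_cone_iff {Z : Set (ℙ ℂ (σ → ℂ))} {w : σ → ℂ} (hw : w ≠ 0) :
    w ∈ cone Z ↔ Projectivization.mk ℂ w hw ∈ Z := by
  constructor
  · rintro ⟨p, hp, hwp⟩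
    induction p with
    | h v hv =>
      rw [Projectivization.submodule_mk, Submodule.mem_span_singleton] at hwp
      rwa [(Projectivization.mk_eq_mk_iff' ℂ w v hw hv).2 hwp]
  · intro h
    exact ⟨_, h, by simp [Projectivization.submodule_mk]⟩

theorem mem_idealOf {Z : Set (ℙ ℂ (σ → ℂ))} {f : MvPolynomial σ ℂ} :
    f ∈ idealOf Z ↔ ∀ w ∈ cone Z, eval w f = 0 := by
  simp [idealOf, mem_vanishingIdeal_iff, aeval_eq_eval]

theorem subset_zariskiClosure (Z : Set (ℙ ℂ (σ → ℂ))) : Z ⊆ zariskiClosure Z :=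
  fun p hp _ hf w hw => mem_idealOf.1 hf w ⟨p, hp, hw⟩

theorem idealOf_zariskiClosure (Z : Set (ℙ ℂ (σ → ℂ))) : idealOf (zariskiClosure Z) = idealOf Z := by
  ext f
  rw [mem_idealOf, mem_idealOf]
  constructor
  · rintro h w ⟨p, hp, hw⟩
    exact h w ⟨p, subset_zariskiClosure Z hp, hw⟩
  · rintro h w ⟨p, hp, hw⟩
    exact hp f (mem_idealOf.2 h) w hw

theorem mk_mem_zariskiClosure_iff {Z : Set (ℙ ℂ (σ → ℂ))} {w : σ → ℂ} (hw : w ≠ 0) :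
    Projectivization.mk ℂ w hw ∈ zariskiClosure Z ↔
      ∀ f ∈ idealOf Z, ∀ c : ℂ, eval (c • w) f = 0 := by
  simp [zariskiClosure, Projectivization.submodule_mk, Submodule.mem_span_singleton]

theorem mem_cone_preimage (e : (σ → ℂ) ≃ₗ[ℂ] (τ → ℂ)) {X : Set (ℙ ℂ (τ → ℂ))} {w : σ → ℂ} :
    w ∈ cone (Projectivization.map e.toLinearMap e.injective ⁻¹' X) ↔ e w ∈ cone X := by
  -- The zero vector has no class in projective space: it belongs to the cone over a set precisely
  -- when the set is nonempty.
  by_cases hw : w = 0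
  · subst hw
    rw [map_zero]
    constructor
    · rintro ⟨p, hp, -⟩
      exact ⟨_, hp, zero_mem _⟩
    · rintro ⟨p, hp, -⟩
      induction p with
      | h v hv =>
        refine ⟨Projectivization.mk ℂ (e.symm v) (by simpa using hv), ?_, zero_mem _⟩
        simpa [Projectivization.map_mk] using hp
  · rw [mem_cone_iff hw, mem_cone_iff (by simpa using hw)]
    rfl

variable [Fintype σ] [DecidableEq σ]

/-- The substitution homomorphism given by a linear map. -/
def linearSubst (φ : (σ → ℂ) →ₗ[ℂ] (τ → ℂ)) : MvPolynomial τ ℂ →ₐ[ℂ] MvPolynomial σ ℂ :=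
  aeval fun t : τ => ∑ k : σ, C (φ (Pi.single k 1) t) * X k

theorem pullbackIdeal_eq_map (φ : (σ → ℂ) →ₗ[ℂ] (τ → ℂ)) (J : Ideal (MvPolynomial τ ℂ)) :
    pullbackIdeal φ J = J.map (linearSubst φ) := rfl

theorem eval_linearSubst (φ : (σ → ℂ) →ₗ[ℂ] (τ → ℂ)) (w : σ → ℂ) (f : MvPolynomial τ ℂ) :
    eval w (linearSubst φ f) = eval (φ w) f := by
  have : (aeval w).comp (linearSubst φ) = (aeval (φ w) : _ →ₐ[ℂ] ℂ) := by
    refine algHom_ext fun t => ?_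
    rw [AlgHom.comp_apply, linearSubst, aeval_X, aeval_X, φ.pi_apply_eq_sum_univ w]
    have : ∀ k : σ, (fun j : σ => if k = j then (1 : ℂ) else 0) = Pi.single k 1 := fun k =>
      funext fun j => by rw [Pi.single_apply]; exact if_congr eq_comm rfl rfl
    simp [mul_comm, Finset.sum_apply, this]
  simpa [aeval_eq_eval] using DFunLike.congr_fun this f

theorem linearSubst_comp [Fintype τ] [DecidableEq τ] (φ : (σ → ℂ) →ₗ[ℂ] (τ → ℂ))
    (ψ : (τ → ℂ) →ₗ[ℂ] (υ → ℂ)) :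
    linearSubst (ψ ∘ₗ φ) = (linearSubst φ).comp (linearSubst ψ) := by
  refine AlgHom.ext fun f => MvPolynomial.funext fun w => ?_
  rw [AlgHom.comp_apply, eval_linearSubst, eval_linearSubst, eval_linearSubst, LinearMap.comp_apply]

theorem linearSubst_id : linearSubst (LinearMap.id : (σ → ℂ) →ₗ[ℂ] (σ → ℂ)) = AlgHom.id ℂ _ := by
  refine AlgHom.ext fun f => MvPolynomial.funext fun w => ?_
  rw [eval_linearSubst, LinearMap.id_apply, AlgHom.id_apply]

/-- The change of coordinates given by a linear equivalence. -/
def linearSubstEquiv [Fintype τ] [DecidableEq τ] (e : (σ → ℂ) ≃ₗ[ℂ] (τ → ℂ)) :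
    MvPolynomial τ ℂ ≃ₐ[ℂ] MvPolynomial σ ℂ :=
  AlgEquiv.ofAlgHom (linearSubst e.toLinearMap) (linearSubst e.symm.toLinearMap)
    (by rw [← linearSubst_comp, LinearEquiv.comp_coe, LinearEquiv.self_trans_symm]
        exact linearSubst_id)
    (by rw [← linearSubst_comp, LinearEquiv.comp_coe, LinearEquiv.symm_trans_self]
        exact linearSubst_id)

theorem map_linearSubst_irrelevant_le (φ : (σ → ℂ) →ₗ[ℂ] (τ → ℂ)) :
    (irrelevant τ).map (linearSubst φ) ≤ irrelevant σ := by
  rw [irrelevant, Ideal.map_span, Ideal.span_le]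
  rintro _ ⟨_, ⟨t, rfl⟩, rfl⟩
  rw [linearSubst, aeval_X]
  exact sum_mem fun k _ => Ideal.mul_mem_left _ _ (X_mem_irrelevant k)

theorem linearSubst_mem_irrelevant_pow (φ : (σ → ℂ) →ₗ[ℂ] (τ → ℂ)) {n : ℕ} {g : MvPolynomial τ ℂ}
    (hg : g ∈ irrelevant τ ^ n) : linearSubst φ g ∈ irrelevant σ ^ n := by
  have := Ideal.mem_map_of_mem (linearSubst φ) hg
  rw [Ideal.map_pow] at this
  exact Ideal.pow_right_mono (map_linearSubst_irrelevant_le φ) n this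

variable [Fintype τ] [DecidableEq τ] (e : (σ → ℂ) ≃ₗ[ℂ] (τ → ℂ))

theorem eval_linearSubstEquiv (w : σ → ℂ) (f : MvPolynomial τ ℂ) :
    eval w (linearSubstEquiv e f) = eval (e w) f :=
  eval_linearSubst e.toLinearMap w f

/-- A linear change of coordinates and its inverse both preserve the powers of the irrelevant ideal.
-/
theorem saturation_map_linearSubst (I : Ideal (MvPolynomial τ ℂ)) :
    saturation (I.map (linearSubst e.toLinearMap)) = (linearSubstEquiv e).symm ⁻¹' saturation I := by
  have hI : ∀ f, f ∈ I.map (linearSubst e.toLinearMap) ↔ (linearSubstEquiv e).symm f ∈ I := by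
    intro f
    have : I.map (linearSubst e.toLinearMap) = I.map (linearSubstEquiv e).toRingEquiv := rfl
    rw [this, Ideal.mem_map_of_equiv]
    constructor
    · rintro ⟨g, hg, rfl⟩
      change (linearSubstEquiv e).symm (linearSubstEquiv e g) ∈ I
      rwa [AlgEquiv.symm_apply_apply]
    · intro h
      exact ⟨_, h, (linearSubstEquiv e).apply_symm_apply f⟩
  ext f
  constructor
  · rintro ⟨n, hn⟩
    refine ⟨n, fun g hg => ?_⟩
    have := (hI _).1 (hn _ (linearSubst_mem_irrelevant_pow e.toLinearMap hg))
    rw [map_mul] at this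
    convert this using 2
    exact ((linearSubstEquiv e).symm_apply_apply g).symm
  · rintro ⟨n, hn⟩
    refine ⟨n, fun g hg => ?_⟩
    rw [hI, map_mul]
    exact hn _ (linearSubst_mem_irrelevant_pow e.symm.toLinearMap hg)

theorem idealOf_preimage (X : Set (ℙ ℂ (τ → ℂ))) :
    idealOf (Projectivization.map e.toLinearMap e.injective ⁻¹' X) =
      (idealOf X).map (linearSubst e.toLinearMap) := by
  have : (idealOf X).map (linearSubst e.toLinearMap) =
    (idealOf X).map (linearSubstEquiv e).toRingEquiv := rfl
  ext f
  rw [this, Ideal.mem_map_of_equiv, mem_idealOf]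
  constructor
  · intro h
    refine ⟨(linearSubstEquiv e).symm f, mem_idealOf.2 fun w hw => ?_,
      (linearSubstEquiv e).apply_symm_apply f⟩
    have := h (e.symm w) (by rw [mem_cone_preimage]; simpa using hw)
    rw [← (linearSubstEquiv e).apply_symm_apply f, eval_linearSubstEquiv] at this
    simpa using this
  · rintro ⟨g, hg, rfl⟩ w hw
    rw [mem_cone_preimage] at hw
    exact (eval_linearSubstEquiv e w g).trans (mem_idealOf.1 hg _ hw)

theorem zariskiClosure_preimage (Z : Set (ℙ ℂ (τ → ℂ))) :
    zariskiClosure (Projectivization.map e.toLinearMap e.injective ⁻¹' Z) =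
      Projectivization.map e.toLinearMap e.injective ⁻¹' zariskiClosure Z := by
  ext p
  induction p with
  | h w hw =>
    rw [Set.mem_preimage, Projectivization.map_mk, mk_mem_zariskiClosure_iff, mk_mem_zariskiClosure_iff,
       idealOf_preimage]
    constructor
    · intro h f hf c
      have := h _ (Ideal.mem_map_of_mem (linearSubst e.toLinearMap) hf) c
      rwa [eval_linearSubst, map_smul] at this
    · intro h f hf c
      rw [show (idealOf Z).map (linearSubst e.toLinearMap) =
        (idealOf Z).map (linearSubstEquiv e).toRingEquiv from rfl, Ideal.mem_map_of_equiv] at hf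
      obtain ⟨g, hg, rfl⟩ := hf
      refine (eval_linearSubstEquiv e (c • w) g).trans ?_
      rw [map_smul]
      exact h g hg c

/-- This reduces an arbitrary projection from the node to the one given by Plücker coordinates. -/
theorem IsLinearSectionOf.preimage {X : Set (ℙ ℂ (τ → ℂ))} {Y : Set (ℙ ℂ (υ → ℂ))}
    (h : IsLinearSectionOf X Y) :
    IsLinearSectionOf (Projectivization.map e.toLinearMap e.injective ⁻¹' X) Y := by
  obtain ⟨φ, hφ, hX, hsat⟩ := h
  refine ⟨φ ∘ₗ e.toLinearMap, hφ.comp e.injective, ?_, ?_⟩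
  · rw [hX]
    ext p
    induction p with
    | h w hw => rfl
  · rw [idealOf_preimage, saturation_map_linearSubst, hsat, pullbackIdeal_eq_map,
      pullbackIdeal_eq_map, linearSubst_comp, ← saturation_map_linearSubst]
    congr 1
    exact Ideal.map_map _ _

end Substitution

/-! ### The section of the spinor tenfold defined by the ten quadrics -/

section SpinorSection

open MvPolynomial

/-- The coordinates of the linear section of the space of half-spinors cut out by
`s ∅ = s {1, 2, 3, 4} = s {1, 2} + s {3, 4} = 0`. -/
def spinorSection {R : Type*} [CommRing R] (w : Fin 13 → R) : EvenSubset → R :=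
  ![0, w 0, w 1, w 2, w 3, w 8, w 9, w 10, w 11, w 12, -w 8, 0, -w 5, -w 4, -w 7, -w 6] ∘
    evenIdx.symm

theorem map_spinorSection {R S : Type*} [CommRing R] [CommRing S] (f : R →+* S) (w : Fin 13 → R)
    (J : EvenSubset) : f (spinorSection w J) = spinorSection (fun i => f (w i)) J := by
  obtain ⟨j, rfl⟩ := evenIdx.surjective J
  fin_cases j <;> simp [spinorSection]

theorem map_spinorForm {R S : Type*} [CommRing R] [CommRing S] (f : R →+* S)
    (s : EvenSubset → R) :
    (∀ i, f ((spinorForm s).1 i) = (spinorForm fun J => f (s J)).1 i) ∧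
      ∀ i, f ((spinorForm s).2 i) = (spinorForm fun J => f (s J)).2 i := by
  constructor <;> intro i <;> fin_cases i <;>
    simp only [spinorForm, Matrix.cons_val, Fin.zero_eta, Fin.mk_one, Fin.reduceFinMk, map_add,
      map_sub, map_mul, map_neg]

/-- The link between the two sides. The coordinates at four-element subsets containing `0` hold `b`,
moved to `⋀³F` by the symplectic form; this accounts for the order `-w 5, -w 4, -w 7, -w 6`. The
spinor quadrics contract `β` with `b`, and for `β` of trace zero this agrees up to sign with `b ∧
β`. -/
theorem spinorForm_spinorSection {R : Type*} [CommRing R] (w : Fin 13 → R) :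
    spinorForm (spinorSection w) =
      (![quadrics w 9, quadrics w 7, quadrics w 8, quadrics w 5, quadrics w 6],
        ![quadrics w 0, quadrics w 4, -quadrics w 3, quadrics w 2, -quadrics w 1]) := by
  refine Prod.ext ?_ ?_ <;> funext i <;> fin_cases i <;>
    simp only [spinorForm, spinorSection, quadrics, Matrix.cons_val, Function.comp_apply,
      Equiv.symm_apply_apply, Fin.zero_eta, Fin.mk_one, Fin.reduceFinMk] <;>
    ring

/-- The embedding of the linear section in the space of half-spinors. -/
def spinorEmbedding : (Fin 13 → ℂ) →ₗ[ℂ] (EvenSubset → ℂ) where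
  toFun := spinorSection
  map_add' w w' := by
    funext J
    obtain ⟨j, rfl⟩ := evenIdx.surjective J
    fin_cases j <;> simp [spinorSection] <;> ring
  map_smul' c w := by
    funext J
    obtain ⟨j, rfl⟩ := evenIdx.surjective J
    fin_cases j <;> simp [spinorSection]

theorem spinorEmbedding_injective : Function.Injective spinorEmbedding := by
  rw [← LinearMap.ker_eq_bot, LinearMap.ker_eq_bot']
  intro w hw
  have h : ∀ j, spinorSection w (evenIdx j) = 0 := fun j => congrFun hw _
  have h1 := h 1
  have h2 := h 2
  have h3 := h 3
  have h4 := h 4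
  have h5 := h 5
  have h6 := h 6
  have h7 := h 7
  have h8 := h 8
  have h9 := h 9
  have h12 := h 12
  have h13 := h 13
  have h14 := h 14
  have h15 := h 15
  simp only [spinorSection, Function.comp_apply, Equiv.symm_apply_apply, Matrix.cons_val,
    neg_eq_zero] at h1 h2 h3 h4 h5 h6 h7 h8 h9 h12 h13 h14 h15
  funext i
  fin_cases i <;> assumption

theorem linearSubst_spinorEmbedding_X (J : EvenSubset) :
    linearSubst spinorEmbedding (X J) = spinorSection X J := by
  refine MvPolynomial.funext fun w => ?_
  rw [eval_linearSubst, eval_X, map_spinorSection]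
  simp only [eval_X]
  rfl

theorem spinorForm_X_mem_idealOf :
    (∀ i, (spinorForm X).1 i ∈ idealOf spinorTenfold) ∧
      ∀ i, (spinorForm X).2 i ∈ idealOf spinorTenfold := by
  have h : ∀ s ∈ cone spinorTenfold, spinorForm (fun J => eval s (X J)) = 0 := by
    rintro s ⟨p, hp, hs⟩
    simp only [eval_X]
    exact spinorForm_eq_zero_of_mem hp hs
  constructor <;> intro i <;> rw [mem_idealOf] <;> intro s hs
  · rw [(map_spinorForm (eval s) X).1, h s hs]
    rfl
  · rw [(map_spinorForm (eval s) X).2, h s hs]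
    rfl

/-- Only this inclusion is needed. That the ten quadrics generate the whole ideal of the spinor
tenfold is never used, since the opposite comparison goes through saturation. -/
theorem quadricIdeal_le_pullbackIdeal :
    quadricIdeal ≤ pullbackIdeal spinorEmbedding (idealOf spinorTenfold) := by
  rw [quadricIdeal, Ideal.span_le, pullbackIdeal_eq_map]
  have e : spinorForm (fun J => linearSubst spinorEmbedding (X J)) = _ :=
    (congrArg spinorForm (funext linearSubst_spinorEmbedding_X)).trans (spinorForm_spinorSection X)
  have h1 : ∀ i, _ := fun i => Ideal.mem_map_of_mem (linearSubst spinorEmbedding)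
    (spinorForm_X_mem_idealOf.1 i)
  have h2 : ∀ i, _ := fun i => Ideal.mem_map_of_mem (linearSubst spinorEmbedding)
    (spinorForm_X_mem_idealOf.2 i)
  have m1 : ∀ i, _ := (map_spinorForm (linearSubst spinorEmbedding).toRingHom X).1
  have m2 : ∀ i, _ := (map_spinorForm (linearSubst spinorEmbedding).toRingHom X).2
  simp only [AlgHom.toRingHom_eq_coe, RingHom.coe_coe] at m1 m2
  simp only [m1, m2, e] at h1 h2
  rintro _ ⟨k, rfl⟩
  fin_cases k
  exacts [h2 0, neg_mem_iff.1 (h2 4), h2 3, neg_mem_iff.1 (h2 2), h2 1, h1 3, h1 4, h1 1, h1 2,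
    h1 0]

theorem map_spinorEmbedding_mem {w : Fin 13 → ℂ} (hw : w ≠ 0) (h : ∀ k, quadrics w k = 0) :
    Projectivization.map spinorEmbedding spinorEmbedding_injective (Projectivization.mk ℂ w hw) ∈
      spinorTenfold := by
  have hne : spinorSection w ≠ 0 := (map_ne_zero_iff spinorEmbedding spinorEmbedding_injective).2 hw
  refine mem_spinorTenfold_of_spinorForm_eq_zero (s := spinorSection w) ?_ hne ?_
  · rw [Projectivization.map_mk, Projectivization.submodule_mk]
    rfl
  · rw [spinorForm_spinorSection]
    simp only [h, neg_zero]
    refine Prod.ext ?_ ?_ <;> funext i <;> fin_cases i <;> rfl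

variable {Z : Set (ℙ ℂ (Fin 13 → ℂ))}

/-- The content is the case `β = 0`. If `f` vanishes on `Z`, then `X i ^ n * f` lies in the quadric
ideal for every `i`; choosing `i` with nonzero coordinate at the point forces `f` to vanish there.
-/
theorem mk_mem_zariskiClosure_of_quadrics_eq_zero (hZ : bivectorLocus ⊆ cone Z) {w : Fin 13 → ℂ}
    (hw : w ≠ 0) (h : ∀ k, quadrics w k = 0) :
    Projectivization.mk ℂ w hw ∈ zariskiClosure Z := by
  rw [mk_mem_zariskiClosure_iff]
  intro f hf c
  by_cases hc : c • w = 0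
  · -- the origin lies on every nonempty cone
    have h1 : (![0, 0, 0, 0, 0, 0, 0, 0, 0, 1, 0, 0, 0] : Fin 13 → ℂ) ∈ bivectorLocus := by
      refine ⟨fun k => ?_, 9, le_rfl, ?_⟩
      · fin_cases k <;> simp [quadrics]
      · simp
    obtain ⟨p, hp, -⟩ := hZ h1
    rw [hc]
    exact mem_idealOf.1 hf 0 ⟨p, hp, zero_mem _⟩
  · have hq : ∀ k, quadrics (c • w) k = 0 := by
      intro k
      rw [quadrics_smul, h, mul_zero]
    obtain ⟨n, hn⟩ := mem_saturation_quadricIdeal (f := f) (n := 0) fun g _ v hv => by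
      rw [map_mul, mem_idealOf.1 hf v (hZ hv), mul_zero]
    obtain ⟨i, hi⟩ := Function.ne_iff.1 hc
    have := eval_eq_zero_of_mem_quadricIdeal
      (hn _ (Ideal.pow_mem_pow (X_mem_irrelevant i) n)) hq
    rw [map_mul, map_pow, eval_X] at this
    exact (mul_eq_zero.1 this).resolve_left (pow_ne_zero n hi)

/-- The quadric ideal lies in the pullback of the spinor ideal, which lies in the ideal of the
closure. The latter lies in the saturation of the quadric ideal, so all three have the same
saturation. -/
theorem isLinearSectionOf_zariskiClosure (hZ : bivectorLocus ⊆ cone Z)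
    (hq : ∀ w ∈ cone Z, ∀ k, quadrics w k = 0) :
    IsLinearSectionOf (zariskiClosure Z) spinorTenfold := by
  have hideal : quadricIdeal ≤ idealOf Z := by
    rw [quadricIdeal, Ideal.span_le]
    rintro _ ⟨k, rfl⟩
    exact mem_idealOf.2 fun w hw => (eval_quadrics w k).trans (hq w hw k)
  have hX : zariskiClosure Z =
      Projectivization.map spinorEmbedding spinorEmbedding_injective ⁻¹' spinorTenfold := by
    ext p
    induction p with
    | h w hw =>
      constructor
      · intro h
        refine map_spinorEmbedding_mem hw fun k => ?_
        have := (mk_mem_zariskiClosure_iff hw).1 h _ (hideal (quadrics_mem_quadricIdeal k)) 1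
        rwa [one_smul, eval_quadrics] at this
      · intro h
        refine mk_mem_zariskiClosure_of_quadrics_eq_zero hZ hw fun k => ?_
        have hs := spinorForm_eq_zero_of_mem h (s := spinorSection w) (by
          rw [Projectivization.map_mk, Projectivization.submodule_mk]
          exact Submodule.mem_span_singleton_self _)
        rw [spinorForm_spinorSection] at hs
        have h1 : ∀ i, _ := fun i => congrFun (congrArg Prod.fst hs) i
        have h2 : ∀ i, _ := fun i => congrFun (congrArg Prod.snd hs) i
        fin_cases k
        exacts [h2 0, neg_eq_zero.1 (h2 4), h2 3, neg_eq_zero.1 (h2 2), h2 1, h1 3, h1 4, h1 1,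
          h1 2, h1 0]
  refine ⟨spinorEmbedding, spinorEmbedding_injective, hX, ?_⟩
  have hle : pullbackIdeal spinorEmbedding (idealOf spinorTenfold) ≤ idealOf (zariskiClosure Z) := by
    rw [pullbackIdeal_eq_map, Ideal.map_le_iff_le_comap]
    intro f hf
    rw [Ideal.mem_comap, mem_idealOf]
    rintro w ⟨p, hp, hw⟩
    rw [eval_linearSubst]
    rw [hX] at hp
    refine mem_idealOf.1 hf _ ⟨_, hp, ?_⟩
    induction p with
    | h v hv =>
      rw [Projectivization.submodule_mk, Submodule.mem_span_singleton] at hw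
      obtain ⟨c, rfl⟩ := hw
      rw [Projectivization.map_mk, Projectivization.submodule_mk, map_smul]
      exact Submodule.smul_mem _ c (Submodule.mem_span_singleton_self _)
  refine Set.Subset.antisymm ?_ fun f ⟨n, hn⟩ => ⟨n, fun g hg => hle (hn g hg)⟩
  rintro f ⟨n, hn⟩
  obtain ⟨m, hm⟩ := mem_saturation_quadricIdeal (f := f) (n := n) fun g hg w hw => by
    have := hn g hg
    rw [idealOf_zariskiClosure] at this
    exact mem_idealOf.1 this w (hZ hw)
  exact ⟨m, fun g hg => quadricIdeal_le_pullbackIdeal (hm g hg)⟩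

theorem quadrics_eq_zero_of_bivector_eq_zero {w : Fin 13 → ℂ} (h : ∀ i : Fin 13, 8 ≤ i → w i = 0)
    (h9 : w 0 * w 5 - w 1 * w 4 + w 2 * w 7 - w 3 * w 6 = 0) (k : Fin 10) : quadrics w k = 0 := by
  have e8 := h 8 le_rfl
  have e9 := h 9 (by decide)
  have e10 := h 10 (by decide)
  have e11 := h 11 (by decide)
  have e12 := h 12 (by decide)
  fin_cases k <;> simp [quadrics, e8, e9, e10, e11, e12, h9]

end SpinorSection

/-! ### Bivectors and nodes -/

section Bivector

variable {n : ℕ}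

theorem wedge_add_left (u u' v : Fin n → ℂ) : wedge (u + u') v = wedge u v + wedge u' v :=
  AlternatingMap.map_vecCons_add _ _ _ _

theorem wedge_smul_left (c : ℂ) (u v : Fin n → ℂ) : wedge (c • u) v = c • wedge u v :=
  AlternatingMap.map_vecCons_smul _ _ _ _

theorem wedge_self (u : Fin n → ℂ) : wedge u u = 0 :=
  AlternatingMap.map_eq_zero_of_eq _ _ (i := 0) (j := 1) rfl (by decide)

theorem wedge_swap (u v : Fin n → ℂ) : wedge u v = -wedge v u := by
  have := (exteriorPower.ιMulti ℂ 2 (M := Fin n → ℂ)).map_swap ![v, u] (i := 0) (j := 1) (by decide)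
  rw [wedge, wedge, ← this]
  congr 1
  funext i
  fin_cases i <;> simp

theorem wedge_add_right (u v v' : Fin n → ℂ) : wedge u (v + v') = wedge u v + wedge u v' := by
  rw [wedge_swap, wedge_add_left, neg_add, ← wedge_swap, ← wedge_swap]

theorem wedge_smul_right (c : ℂ) (u v : Fin n → ℂ) : wedge u (c • v) = c • wedge u v := by
  rw [wedge_swap, wedge_smul_left, wedge_swap v u, smul_neg, neg_neg]

/-- The skew-symmetric bilinear form corresponding to a linear form on bivectors. -/
def skewForm (ω : ⋀[ℂ]^2 (Fin n → ℂ) →ₗ[ℂ] ℂ) : (Fin n → ℂ) →ₗ[ℂ] (Fin n → ℂ) →ₗ[ℂ] ℂ :=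
  LinearMap.mk₂ ℂ (fun u v => ω (wedge u v))
    (fun u u' v => by rw [wedge_add_left, map_add])
    (fun c u v => by rw [wedge_smul_left, map_smul])
    (fun u v v' => by rw [wedge_add_right, map_add])
    (fun c u v => by rw [wedge_smul_right, map_smul])

theorem skewForm_apply (ω : ⋀[ℂ]^2 (Fin n → ℂ) →ₗ[ℂ] ℂ) (u v : Fin n → ℂ) :
    skewForm ω u v = ω (wedge u v) := rfl

theorem skewForm_self (ω : ⋀[ℂ]^2 (Fin n → ℂ) →ₗ[ℂ] ℂ) (u : Fin n → ℂ) : skewForm ω u u = 0 := by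
  rw [skewForm_apply, wedge_self, map_zero]

theorem skewForm_swap (ω : ⋀[ℂ]^2 (Fin n → ℂ) →ₗ[ℂ] ℂ) (u v : Fin n → ℂ) :
    skewForm ω u v = -skewForm ω v u := by
  rw [skewForm_apply, wedge_swap, map_neg, skewForm_apply]

/-- The first derivative of `c + l x + b x x` is `l + (b + b.flip) x`, so the derivatives at the
origin can be read off the coefficients. -/
theorem hasNodeAtZero_quadratic {E : Type*} [NormedAddCommGroup E] [NormedSpace ℂ E] {f : E → ℂ}
    (c : ℂ) (l : E →L[ℂ] ℂ) (b : E →L[ℂ] E →L[ℂ] ℂ) (hf : ∀ x, f x = c + l x + b x x)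
    (h : HasNodeAtZero f) : c = 0 ∧ l = 0 ∧ Function.Injective (b + b.flip) := by
  have hd : ∀ x, HasFDerivAt f (l + (b + b.flip) x) x := by
    intro x
    have h1 := (b.hasFDerivAt (x := x)).clm_apply (hasFDerivAt_id x)
    have h2 := ((l.hasFDerivAt (x := x)).const_add c).add h1
    exact (h2.congr_fderiv rfl).congr_of_eventuallyEq (Filter.Eventually.of_forall hf)
  have hfd : fderiv ℂ f = fun x => l + (b + b.flip) x := funext fun x => (hd x).fderiv
  obtain ⟨h0, h1, h2⟩ := h
  refine ⟨?_, ?_, ?_⟩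
  · simpa [hf] using h0
  · simpa [hfd] using h1
  · have : HasFDerivAt (fderiv ℂ f) (b + b.flip) 0 := by
      rw [hfd]
      exact ((b + b.flip).hasFDerivAt (x := 0)).const_add l
    rwa [this.fderiv] at h2

/-- In the chart the equation is `ω(u,v) + ω(a,v) + ω(u,b) + ω(a,b)`. Vanishing of the constant and
linear terms puts `u` and `v` in the radical, and nondegeneracy of the Hessian makes `ω`
nondegenerate on `C`. -/
theorem IsNode.exists_radical {ω : ⋀[ℂ]^2 (Fin n → ℂ) →ₗ[ℂ] ℂ} {o : ℙ ℂ (⋀[ℂ]^2 (Fin n → ℂ))}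
    (ho : IsNode ω o) : ∃ (u v : Fin n → ℂ) (C : Submodule ℂ (Fin n → ℂ)),
      o.submodule = ℂ ∙ wedge u v ∧ IsCompl (Submodule.span ℂ {u, v}) C ∧
      (∀ x, skewForm ω u x = 0) ∧ (∀ x, skewForm ω v x = 0) ∧
      ∀ a ∈ C, (∀ b ∈ C, skewForm ω a b = 0) → a = 0 := by
  obtain ⟨u, v, C, hp, hC, hnode⟩ := ho
  let B := skewForm ω
  let l : C × C →L[ℂ] ℂ := LinearMap.toContinuousLinearMap
    (B.flip v ∘ₗ C.subtype ∘ₗ LinearMap.fst ℂ C C + B u ∘ₗ C.subtype ∘ₗ LinearMap.snd ℂ C C)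
  let b₀ : C × C →ₗ[ℂ] C × C →ₗ[ℂ] ℂ :=
    B.compl₁₂ (C.subtype ∘ₗ LinearMap.fst ℂ C C) (C.subtype ∘ₗ LinearMap.snd ℂ C C)
  let b : C × C →L[ℂ] C × C →L[ℂ] ℂ := b₀.toContinuousBilinearMap
  have hl : ∀ x : C × C, l x = B x.1 v + B u x.2 := fun _ => rfl
  have hb : ∀ x y : C × C, b x y = B x.1 y.2 := fun _ _ => rfl
  obtain ⟨h0, h1, h2⟩ := hasNodeAtZero_quadratic (B u v) l b (fun x => by
    rw [hl, hb]
    simp only [B, skewForm_apply, wedge_add_left, wedge_add_right, map_add]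
    ring) hnode
  have hCv : ∀ a ∈ C, B a v = 0 := by
    intro a ha
    have := DFunLike.congr_fun h1 ((⟨a, ha⟩, 0) : C × C)
    rw [hl] at this
    simpa using this
  have huC : ∀ a ∈ C, B u a = 0 := by
    intro a ha
    have := DFunLike.congr_fun h1 ((0, ⟨a, ha⟩) : C × C)
    rw [hl] at this
    simpa using this
  have hdec : ∀ x : Fin n → ℂ, ∃ s t : ℂ, ∃ a ∈ C, x = s • u + t • v + a := by
    intro x
    have hx : x ∈ Submodule.span ℂ {u, v} ⊔ C := by rw [hC.sup_eq_top]; trivial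
    obtain ⟨y, hy, a, ha, rfl⟩ := Submodule.mem_sup.1 hx
    obtain ⟨s, t, rfl⟩ := Submodule.mem_span_pair.1 hy
    exact ⟨s, t, a, ha, rfl⟩
  refine ⟨u, v, C, hp, hC, fun x => ?_, fun x => ?_, fun a ha hab => ?_⟩
  · obtain ⟨s, t, a, ha, rfl⟩ := hdec x
    rw [map_add, map_add, map_smul, map_smul, skewForm_self, show skewForm ω u v = 0 from h0,
      show skewForm ω u a = 0 from huC a ha]
    simp
  · obtain ⟨s, t, a, ha, rfl⟩ := hdec x
    rw [map_add, map_add, map_smul, map_smul, skewForm_self, skewForm_swap ω v u,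
      skewForm_swap ω v a, show skewForm ω u v = 0 from h0,
      show skewForm ω a v = 0 from hCv a ha]
    simp
  · have : ((⟨a, ha⟩, 0) : C × C) = 0 := by
      apply h2
      ext y
      · simp [hb]
      · simpa [hb] using hab _ y.2
    simpa using this

/-- A nondegenerate skew-symmetric form on a four-dimensional space has a symplectic basis. -/
theorem exists_symplectic_quadruple {ω : ⋀[ℂ]^2 (Fin n → ℂ) →ₗ[ℂ] ℂ}
    {C : Submodule ℂ (Fin n → ℂ)} (hC : Module.finrank ℂ C = 4)
    (h : ∀ a ∈ C, (∀ b ∈ C, skewForm ω a b = 0) → a = 0) :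
    ∃ e₁ e₂ e₃ e₄ : Fin n → ℂ, skewForm ω e₁ e₂ = 1 ∧ skewForm ω e₃ e₄ = 1 ∧
      skewForm ω e₁ e₃ = 0 ∧ skewForm ω e₁ e₄ = 0 ∧ skewForm ω e₂ e₃ = 0 ∧
      skewForm ω e₂ e₄ = 0 := by
  have dual : ∀ a ∈ C, a ≠ 0 → ∃ b ∈ C, skewForm ω a b = 1 := by
    intro a ha hne
    by_contra! hcon
    refine hne (h a ha fun b hb => ?_)
    by_contra hab
    refine hcon ((skewForm ω a b)⁻¹ • b) (C.smul_mem _ hb) ?_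
    rw [map_smul, smul_eq_mul, inv_mul_cancel₀ hab]
  obtain ⟨e₁, he₁, hne₁⟩ := Submodule.exists_mem_ne_zero_of_ne_bot
    (show C ≠ ⊥ by rintro rfl; simp at hC)
  obtain ⟨e₂, he₂, h12⟩ := dual e₁ he₁ hne₁
  -- Two linear conditions on a four-dimensional space leave a nonzero `e₃` orthogonal to `e₁` and
  -- `e₂`.
  let f : C →ₗ[ℂ] (Fin 2 → ℂ) := LinearMap.pi ![skewForm ω e₁ ∘ₗ C.subtype, skewForm ω e₂ ∘ₗ C.subtype]
  obtain ⟨⟨e₃, he₃⟩, hker, hne₃⟩ := Submodule.exists_mem_ne_zero_of_ne_bot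
    (LinearMap.ker_ne_bot_of_finrank_lt (f := f) (by simp [hC]))
  have h13 : skewForm ω e₁ e₃ = 0 := congrFun hker 0
  have h23 : skewForm ω e₂ e₃ = 0 := congrFun hker 1
  obtain ⟨z, -, h3z⟩ := dual e₃ he₃ (fun h0 => hne₃ (Subtype.ext h0))
  have h21 : skewForm ω e₂ e₁ = -1 := by rw [skewForm_swap, h12]
  have h31 : skewForm ω e₃ e₁ = 0 := by rw [skewForm_swap, h13, neg_zero]
  have h32 : skewForm ω e₃ e₂ = 0 := by rw [skewForm_swap, h23, neg_zero]
  -- Symplectic Gram–Schmidt: the correction makes the last vector orthogonal to `e₁` and `e₂`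
  -- without changing its pairing with `e₃`.
  refine ⟨e₁, e₂, e₃, z - skewForm ω e₁ z • e₂ + skewForm ω e₂ z • e₁, h12, ?_, h13, ?_, h23, ?_⟩
  · simp [h3z, h31, h32]
  · simp [h12, skewForm_self]
  · simp [h21, skewForm_self]

/-- At a node of a section of `G(2, 6)`, the linear form is `p₂₃ + p₄₅` in suitable
coordinates in which the node is `e₀ ∧ e₁`. -/
theorem IsNode.exists_basis {ω : ⋀[ℂ]^2 (Fin 6 → ℂ) →ₗ[ℂ] ℂ} {o : ℙ ℂ (⋀[ℂ]^2 (Fin 6 → ℂ))}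
    (ho : IsNode ω o) : ∃ b : Module.Basis (Fin 6) ℂ (Fin 6 → ℂ),
      o.submodule = ℂ ∙ wedge (b 0) (b 1) ∧ ∀ i j, i < j →
        skewForm ω (b i) (b j) = if i = 2 ∧ j = 3 ∨ i = 4 ∧ j = 5 then 1 else 0 := by
  obtain ⟨u, v, C, hp, hC, hu, hv, hnd⟩ := ho.exists_radical
  have hne : wedge u v ≠ 0 := by
    intro h0
    rw [h0, Submodule.span_zero_singleton] at hp
    have := o.finrank_submodule
    rw [hp] at this
    simp at this
  have huv : LinearIndependent ℂ ![u, v] := by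
    rw [LinearIndependent.pair_iff]
    intro s t hst
    constructor
    · have : wedge (s • u + t • v) v = 0 := by
        rw [hst, ← zero_smul ℂ u, wedge_smul_left, zero_smul]
      rw [wedge_add_left, wedge_smul_left, wedge_smul_left, wedge_self, smul_zero, add_zero] at this
      exact (smul_eq_zero.1 this).resolve_right hne
    · have : wedge u (s • u + t • v) = 0 := by
        rw [hst, ← zero_smul ℂ u, wedge_smul_right, zero_smul]
      rw [wedge_add_right, wedge_smul_right, wedge_smul_right, wedge_self, smul_zero,
        zero_add] at this
      exact (smul_eq_zero.1 this).resolve_right hne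
  have hC4 : Module.finrank ℂ C = 4 := by
    have h1 := Submodule.finrank_add_eq_of_isCompl hC
    have h2 := finrank_span_eq_card huv
    rw [Matrix.range_cons, Matrix.range_cons, Matrix.range_empty, Set.union_empty,
      Set.singleton_union] at h2
    rw [h2] at h1
    simp at h1
    omega
  obtain ⟨e₁, e₂, e₃, e₄, h12, h34, h13, h14, h23, h24⟩ := exists_symplectic_quadruple hC4 hnd
  have h21 : skewForm ω e₂ e₁ = -1 := by rw [skewForm_swap, h12]
  have h43 : skewForm ω e₄ e₃ = -1 := by rw [skewForm_swap, h34]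
  have h31 : skewForm ω e₃ e₁ = 0 := by rw [skewForm_swap, h13, neg_zero]
  have h41 : skewForm ω e₄ e₁ = 0 := by rw [skewForm_swap, h14, neg_zero]
  have h32 : skewForm ω e₃ e₂ = 0 := by rw [skewForm_swap, h23, neg_zero]
  have h42 : skewForm ω e₄ e₂ = 0 := by rw [skewForm_swap, h24, neg_zero]
  have hli : LinearIndependent ℂ ![u, v, e₁, e₂, e₃, e₄] := by
    rw [Fintype.linearIndependent_iff]
    intro g hg
    have hg' : g 0 • u + g 1 • v + g 2 • e₁ + g 3 • e₂ + g 4 • e₃ + g 5 • e₄ = 0 := by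
      simpa [Fin.sum_univ_six] using hg
    -- Pairing a relation with the symplectic vectors removes `u` and `v` and isolates the last four
    -- coefficients one by one.
    have hB : ∀ y, skewForm ω (g 0 • u + g 1 • v + g 2 • e₁ + g 3 • e₂ + g 4 • e₃ + g 5 • e₄) y
        = 0 := by
      intro y
      rw [hg', map_zero, LinearMap.zero_apply]
    simp only [map_add, map_smul, LinearMap.add_apply, LinearMap.smul_apply, hu, hv, smul_eq_mul,
      mul_zero, zero_add] at hB
    have g2 : g 2 = 0 := by simpa [h12, skewForm_self, h32, h42] using hB e₂
    have g3 : g 3 = 0 := by simpa [h21, skewForm_self, h31, h41] using hB e₁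
    have g4 : g 4 = 0 := by simpa [h34, skewForm_self, h14, h24] using hB e₄
    have g5 : g 5 = 0 := by simpa [h43, skewForm_self, h13, h23] using hB e₃
    have g01 : g 0 = 0 ∧ g 1 = 0 := by
      rw [g2, g3, g4, g5] at hg'
      exact LinearIndependent.pair_iff.1 huv _ _ (by simpa using hg')
    intro i
    fin_cases i
    exacts [g01.1, g01.2, g2, g3, g4, g5]
  refine ⟨basisOfLinearIndependentOfCardEqFinrank hli (by simp), ?_, ?_⟩
  · rw [coe_basisOfLinearIndependentOfCardEqFinrank]
    exact hp
  · rw [coe_basisOfLinearIndependentOfCardEqFinrank]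
    intro i j hij
    fin_cases i <;> fin_cases j <;>
      first
      | exact absurd hij (by decide)
      | simp [hu, hv, h12, h34, h13, h14, h23, h24]

end Bivector

/-! ### Plücker coordinates -/

section Pluecker

variable {n : ℕ} (b : Module.Basis (Fin n) ℂ (Fin n → ℂ))

/-- The Plücker coordinate `p i j` on bivectors, with respect to a basis. -/
def pluecker (i j : Fin n) : ⋀[ℂ]^2 (Fin n → ℂ) →ₗ[ℂ] ℂ :=
  exteriorPower.pairingDual ℂ (Fin n → ℂ) 2 (exteriorPower.ιMulti ℂ 2 ![b.coord i, b.coord j])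

theorem pluecker_wedge (i j : Fin n) (x y : Fin n → ℂ) :
    pluecker b i j (wedge x y) = b.repr x i * b.repr y j - b.repr x j * b.repr y i := by
  rw [pluecker, wedge, exteriorPower.pairingDual_ιMulti_ιMulti, Matrix.det_fin_two]
  simp

variable {b} in
theorem bivector_linearMap_ext {N : Type*} [AddCommGroup N] [Module ℂ N]
    {F G : ⋀[ℂ]^2 (Fin n → ℂ) →ₗ[ℂ] N}
    (h : ∀ i j, i < j → F (wedge (b i) (b j)) = G (wedge (b i) (b j))) : F = G := by
  refine exteriorPower.linearMap_ext (Module.Basis.ext_alternating b fun v hv => ?_)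
  have hw : exteriorPower.ιMulti ℂ 2 (fun i => b (v i)) = wedge (b (v 0)) (b (v 1)) := by
    rw [wedge]
    congr 1
    funext i
    fin_cases i <;> rfl
  simp only [LinearMap.compAlternatingMap_apply, hw]
  rcases lt_or_gt_of_ne (hv.ne (show (0 : Fin 2) ≠ 1 by decide)) with hlt | hlt
  · exact h _ _ hlt
  · rw [wedge_swap, map_neg, map_neg, h _ _ hlt]

theorem sum_sum_ite_smul {N : Type*} [AddCommGroup N] [Module ℂ N] (W : Fin n → Fin n → N)
    (k l : Fin n) :
    ∑ i, ∑ j, ((if k = i then (1 : ℂ) else 0) * (if l = j then 1 else 0) -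
      (if k = j then 1 else 0) * (if l = i then 1 else 0)) • W i j = W k l - W l k := by
  simp [sub_smul, Finset.sum_sub_distrib, ite_smul]

/-- The factor `2⁻¹` compensates for the sum over all ordered pairs, in which each basis bivector
occurs twice. -/
theorem eq_sum_pluecker (p : ⋀[ℂ]^2 (Fin n → ℂ)) :
    p = (2⁻¹ : ℂ) • ∑ i, ∑ j, pluecker b i j p • wedge (b i) (b j) := by
  let F : ⋀[ℂ]^2 (Fin n → ℂ) →ₗ[ℂ] ⋀[ℂ]^2 (Fin n → ℂ) :=
    (2⁻¹ : ℂ) • ∑ i, ∑ j, (pluecker b i j).smulRight (wedge (b i) (b j))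
  have : LinearMap.id = F := by
    refine bivector_linearMap_ext (b := b) fun k l _ => ?_
    have h2 : ∑ i, ∑ j, pluecker b i j (wedge (b k) (b l)) • wedge (b i) (b j) =
        (2 : ℂ) • wedge (b k) (b l) := by
      simp only [pluecker_wedge, Module.Basis.repr_self, Finsupp.single_apply]
      refine (sum_sum_ite_smul (fun i j => wedge (b i) (b j)) k l).trans ?_
      rw [wedge_swap (b l) (b k), sub_neg_eq_add, two_smul]
    simp only [F, LinearMap.id_apply, LinearMap.smul_apply, LinearMap.sum_apply,
      LinearMap.smulRight_apply, h2, smul_smul]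
    norm_num
  have h := LinearMap.congr_fun this p
  simpa [F] using h

end Pluecker

/-! ### The projection from the node in coordinates -/

section NodeCoordinates

variable (b : Module.Basis (Fin 6) ℂ (Fin 6 → ℂ))

/-- The coordinates on the target of the projection from the point `b 0 ∧ b 1` of the hyperplane
`p₂₃ + p₄₅ = 0`. -/
def nodeCoordinates : ⋀[ℂ]^2 (Fin 6 → ℂ) →ₗ[ℂ] (Fin 13 → ℂ) :=
  LinearMap.pi ![pluecker b 0 2, pluecker b 0 3, pluecker b 0 4, pluecker b 0 5, pluecker b 1 2,
    pluecker b 1 3, pluecker b 1 4, pluecker b 1 5, pluecker b 2 3, pluecker b 2 4,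
    pluecker b 2 5, pluecker b 3 4, pluecker b 3 5]

theorem nodeCoordinates_apply (p : ⋀[ℂ]^2 (Fin 6 → ℂ)) :
    nodeCoordinates b p = ![pluecker b 0 2 p, pluecker b 0 3 p, pluecker b 0 4 p, pluecker b 0 5 p,
      pluecker b 1 2 p, pluecker b 1 3 p, pluecker b 1 4 p, pluecker b 1 5 p, pluecker b 2 3 p,
      pluecker b 2 4 p, pluecker b 2 5 p, pluecker b 3 4 p, pluecker b 3 5 p] := by
  funext i
  fin_cases i <;> rfl

theorem pluecker_swap (i j : Fin 6) (p : ⋀[ℂ]^2 (Fin 6 → ℂ)) :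
    pluecker b i j p = -pluecker b j i p := by
  have : pluecker b i j = -pluecker b j i := by
    refine bivector_linearMap_ext (b := b) fun k l _ => ?_
    rw [LinearMap.neg_apply, pluecker_wedge, pluecker_wedge]
    ring
  exact LinearMap.congr_fun this p

theorem pluecker_self (i : Fin 6) (p : ⋀[ℂ]^2 (Fin 6 → ℂ)) : pluecker b i i p = 0 :=
  self_eq_neg.1 (pluecker_swap b i i p)

/-- The only Plücker coordinates missing from the thirteen are `p₀₁` and `p₄₅`, and on the
hyperplane `p₄₅ = -p₂₃`. Only `p₀₁` stays free. -/
theorem nodeCoordinates_eq_zero_iff {p : ⋀[ℂ]^2 (Fin 6 → ℂ)}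
    (hp : pluecker b 2 3 p + pluecker b 4 5 p = 0) :
    nodeCoordinates b p = 0 ↔ p ∈ ℂ ∙ wedge (b 0) (b 1) := by
  constructor
  · intro h
    have h' : ∀ i, nodeCoordinates b p i = 0 := fun i => congrFun h i
    rw [nodeCoordinates_apply] at h'
    have h02 : pluecker b 0 2 p = 0 := h' 0
    have h03 : pluecker b 0 3 p = 0 := h' 1
    have h04 : pluecker b 0 4 p = 0 := h' 2
    have h05 : pluecker b 0 5 p = 0 := h' 3
    have h12 : pluecker b 1 2 p = 0 := h' 4
    have h13 : pluecker b 1 3 p = 0 := h' 5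
    have h14 : pluecker b 1 4 p = 0 := h' 6
    have h15 : pluecker b 1 5 p = 0 := h' 7
    have h23 : pluecker b 2 3 p = 0 := h' 8
    have h24 : pluecker b 2 4 p = 0 := h' 9
    have h25 : pluecker b 2 5 p = 0 := h' 10
    have h34 : pluecker b 3 4 p = 0 := h' 11
    have h35 : pluecker b 3 5 p = 0 := h' 12
    have h45 : pluecker b 4 5 p = 0 := by simpa [h23] using hp
    have key : ∀ i j, i < j → pluecker b i j p • wedge (b i) (b j) ∈ ℂ ∙ wedge (b 0) (b 1) := by
      intro i j hij
      by_cases h01 : i = 0 ∧ j = 1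
      · rw [h01.1, h01.2]
        exact Submodule.smul_mem _ _ (Submodule.mem_span_singleton_self _)
      · have : pluecker b i j p = 0 := by
          fin_cases i <;> fin_cases j <;>
            first
            | exact absurd hij (by decide)
            | exact absurd ⟨rfl, rfl⟩ h01
            | assumption
        rw [this, zero_smul]
        exact zero_mem _
    rw [eq_sum_pluecker b p]
    refine Submodule.smul_mem _ _ (sum_mem fun i _ => sum_mem fun j _ => ?_)
    rcases lt_trichotomy i j with hij | rfl | hij
    · exact key i j hij
    · rw [pluecker_self, zero_smul]
      exact zero_mem _
    · rw [pluecker_swap b i j, wedge_swap (b i) (b j), smul_neg, neg_smul, neg_neg]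
      exact key j i hij
  · intro h
    obtain ⟨c, rfl⟩ := Submodule.mem_span_singleton.1 h
    rw [nodeCoordinates_apply]
    funext i
    fin_cases i <;> simp [pluecker_wedge]

theorem eq_pluecker_add_pluecker {ω : ⋀[ℂ]^2 (Fin 6 → ℂ) →ₗ[ℂ] ℂ}
    (h : ∀ i j, i < j →
      skewForm ω (b i) (b j) = if i = 2 ∧ j = 3 ∨ i = 4 ∧ j = 5 then 1 else 0) :
    ω = pluecker b 2 3 + pluecker b 4 5 := by
  refine bivector_linearMap_ext (b := b) fun i j hij => ?_
  rw [← skewForm_apply, h i j hij, LinearMap.add_apply, pluecker_wedge, pluecker_wedge]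
  simp only [Module.Basis.repr_self, Finsupp.single_apply]
  fin_cases i <;> fin_cases j <;>
    first
    | exact absurd hij (by decide)
    | simp

/-- The image of the hyperplane section under the projection from the node satisfies the ten
quadratic equations. -/
theorem quadrics_nodeCoordinates_wedge {x y : Fin 6 → ℂ}
    (h : pluecker b 2 3 (wedge x y) + pluecker b 4 5 (wedge x y) = 0) (k : Fin 10) :
    quadrics (nodeCoordinates b (wedge x y)) k = 0 := by
  rw [nodeCoordinates_apply]
  simp only [pluecker_wedge] at h ⊢
  generalize b.repr x = x at *
  generalize b.repr y = y at *
  -- The first nine quadrics are Plücker relations, up to sign, with `p₄₅` replaced by `-p₂₃`, so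
  -- those without `p₄₅` hold identically. The last is the sum of the relations on `0123` and
  -- `0145`, namely `p₀₁ (p₂₃ + p₄₅)`.
  fin_cases k <;> simp only [quadrics, Matrix.cons_val, Fin.zero_eta, Fin.mk_one, Fin.reduceFinMk]
  · linear_combination (x 2 * y 3 - x 3 * y 2) * h
  · ring
  · ring
  · linear_combination -(x 0 * y 2 - x 2 * y 0) * h
  · linear_combination -(x 0 * y 3 - x 3 * y 0) * h
  · ring
  · ring
  · linear_combination -(x 1 * y 2 - x 2 * y 1) * h
  · linear_combination -(x 1 * y 3 - x 3 * y 1) * h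
  · linear_combination (x 0 * y 1 - x 1 * y 0) * h

/-- A solution of the ten quadratic equations with nonzero bivector component is the image of a
decomposable bivector. -/
theorem exists_wedge_of_mem_bivectorLocus {w : Fin 13 → ℂ} (hw : w ∈ bivectorLocus) :
    ∃ x y : Fin 6 → ℂ, nodeCoordinates b (wedge x y) = w ∧
      pluecker b 2 3 (wedge x y) + pluecker b 4 5 (wedge x y) = 0 := by
  obtain ⟨hq, i, hi, hne⟩ := hw
  have q0 := hq 0
  have q1 := hq 1
  have q2 := hq 2
  have q3 := hq 3
  have q4 := hq 4
  have q5 := hq 5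
  have q6 := hq 6
  have q7 := hq 7
  have q8 := hq 8
  have q9 := hq 9
  simp only [quadrics, Matrix.cons_val] at q0 q1 q2 q3 q4 q5 q6 q7 q8 q9
  -- rows of the skew-symmetric matrix of a preimage
  let r₂ : Fin 6 → ℂ := ![-w 0, -w 4, 0, w 8, w 9, w 10]
  let r₃ : Fin 6 → ℂ := ![-w 1, -w 5, -w 8, 0, w 11, w 12]
  let r₄ : Fin 6 → ℂ := ![-w 2, -w 6, -w 9, -w 11, 0, -w 8]
  let r₅ : Fin 6 → ℂ := ![-w 3, -w 7, -w 10, -w 12, w 8, 0]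
  -- For `x ∧ y` the wedge of rows `i` and `j` of its skew matrix is `p i j` times `x ∧ y`. Dividing
  -- the wedge of two rows by a nonzero entry `d` therefore recovers the bivector. Rows 2 to 5 do
  -- not contain `p₀₁`, the coordinate lost in the projection.
  have main : ∀ (d : ℂ) (r r' : Fin 6 → ℂ), d ≠ 0 →
      (∀ i, ![r 0 * r' 2 - r 2 * r' 0, r 0 * r' 3 - r 3 * r' 0, r 0 * r' 4 - r 4 * r' 0,
        r 0 * r' 5 - r 5 * r' 0, r 1 * r' 2 - r 2 * r' 1, r 1 * r' 3 - r 3 * r' 1,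
        r 1 * r' 4 - r 4 * r' 1, r 1 * r' 5 - r 5 * r' 1, r 2 * r' 3 - r 3 * r' 2,
        r 2 * r' 4 - r 4 * r' 2, r 2 * r' 5 - r 5 * r' 2, r 3 * r' 4 - r 4 * r' 3,
        r 3 * r' 5 - r 5 * r' 3] i = d * w i) →
      r 2 * r' 3 - r 3 * r' 2 + (r 4 * r' 5 - r 5 * r' 4) = 0 →
      ∃ x y : Fin 6 → ℂ, nodeCoordinates b (wedge x y) = w ∧
        pluecker b 2 3 (wedge x y) + pluecker b 4 5 (wedge x y) = 0 := by
    intro d r r' hd h1 h2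
    refine ⟨d⁻¹ • b.equivFun.symm r, b.equivFun.symm r', ?_, ?_⟩
    · rw [wedge_smul_left, map_smul, nodeCoordinates_apply]
      funext i
      rw [Pi.smul_apply, smul_eq_mul, inv_mul_eq_iff_eq_mul₀ hd, ← h1 i]
      simp only [pluecker_wedge, ← Module.Basis.equivFun_apply, LinearEquiv.apply_symm_apply]
    · rw [wedge_smul_left, map_smul, map_smul, ← smul_add]
      simp only [pluecker_wedge, ← Module.Basis.equivFun_apply, LinearEquiv.apply_symm_apply, h2,
        smul_zero]
  have : i = 9 ∨ i = 10 ∨ i = 11 ∨ i = 12 := by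
    revert hi; clear hne; revert i; decide
  rcases this with rfl | rfl | rfl | rfl
  · refine main _ r₂ r₄ hne (fun i => ?_) ?_
    · fin_cases i <;>
        simp only [r₂, r₄, Matrix.cons_val, Fin.zero_eta, Fin.mk_one, Fin.reduceFinMk] <;>
        grind
    · simp only [r₂, r₄, Matrix.cons_val]; grind
  · refine main _ r₂ r₅ hne (fun i => ?_) ?_
    · fin_cases i <;>
        simp only [r₂, r₅, Matrix.cons_val, Fin.zero_eta, Fin.mk_one, Fin.reduceFinMk] <;>
        grind
    · simp only [r₂, r₅, Matrix.cons_val]; grind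
  · refine main _ r₃ r₄ hne (fun i => ?_) ?_
    · fin_cases i <;>
        simp only [r₃, r₄, Matrix.cons_val, Fin.zero_eta, Fin.mk_one, Fin.reduceFinMk] <;>
        grind
    · simp only [r₃, r₄, Matrix.cons_val]; grind
  · refine main _ r₃ r₅ hne (fun i => ?_) ?_
    · fin_cases i <;>
        simp only [r₃, r₅, Matrix.cons_val, Fin.zero_eta, Fin.mk_one, Fin.reduceFinMk] <;>
        grind
    · simp only [r₃, r₅, Matrix.cons_val]; grind

end NodeCoordinates

/-! ### The smooth quadric, the image of the section, and the change of projection -/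

section NodalSection

/-- The bilinear form `(a, b; a', b') ↦ ω(a, b')`, where `ω` is the symplectic form. -/
def symplecticPairing : LinearMap.BilinForm ℂ (Fin 13 → ℂ) :=
  LinearMap.mk₂ ℂ (fun w w' => w 0 * w' 5 - w 1 * w' 4 + w 2 * w' 7 - w 3 * w' 6)
    (fun _ _ _ => by simp only [Pi.add_apply]; ring)
    (fun _ _ _ => by simp only [Pi.smul_apply, smul_eq_mul]; ring)
    (fun _ _ _ => by simp only [Pi.add_apply]; ring)
    (fun _ _ _ => by simp only [Pi.smul_apply, smul_eq_mul]; ring)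

/-- The inclusion of the space of pairs of vectors, i.e. of the zero locus of the bivector. -/
def pairInclusion : (Fin 8 → ℂ) →ₗ[ℂ] (Fin 13 → ℂ) :=
  LinearMap.pi fun i => if h : (i : ℕ) < 8 then LinearMap.proj (⟨i, h⟩ : Fin 8) else 0

theorem pairInclusion_apply_of_lt (x : Fin 8 → ℂ) (i : Fin 13) (h : (i : ℕ) < 8) :
    pairInclusion x i = x ⟨i, h⟩ := by
  simp [pairInclusion, h]

theorem pairInclusion_apply_of_le (x : Fin 8 → ℂ) (i : Fin 13) (h : 8 ≤ i) :
    pairInclusion x i = 0 := by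
  have h' : ¬ (i : ℕ) < 8 := not_lt.2 h
  simp [pairInclusion, h']

theorem pairInclusion_injective : Function.Injective pairInclusion := by
  intro x y hxy
  funext i
  have h := congrFun hxy (Fin.castLE (by decide) i)
  rwa [pairInclusion_apply_of_lt x _ i.2, pairInclusion_apply_of_lt y _ i.2] at h

theorem symplecticPairing_pairInclusion (x y : Fin 8 → ℂ) :
    symplecticPairing (pairInclusion x) (pairInclusion y) =
      x 0 * y 5 - x 1 * y 4 + x 2 * y 7 - x 3 * y 6 := rfl

/-- On the `ℙ⁷` where `β = 0` all the quadrics vanish except the pairing of `a` and `b`. As a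
quadratic form in `(a, b)` this is nondegenerate because the symplectic form is. -/
theorem containsSmoothQuadric_preimage {X : Set (ℙ ℂ (Fin 13 → ℂ))}
    (e : (Fin 13 → ℂ) ≃ₗ[ℂ] (Fin 13 → ℂ))
    (hX : ∀ (w : Fin 13 → ℂ) (hw : w ≠ 0), (∀ k, quadrics w k = 0) →
      Projectivization.mk ℂ w hw ∈ X) :
    ContainsSmoothQuadric 6 (Projectivization.map e.toLinearMap e.injective ⁻¹' X) := by
  let J : (Fin 8 → ℂ) →ₗ[ℂ] (Fin 13 → ℂ) := e.symm.toLinearMap ∘ₗ pairInclusion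
  have hJ : Function.Injective J := e.symm.injective.comp pairInclusion_injective
  have heJ : ∀ x, e (J x) = pairInclusion x := fun x => e.apply_symm_apply _
  let L := LinearMap.range J
  let B : LinearMap.BilinForm ℂ L :=
    symplecticPairing.compl₁₂ (e.toLinearMap ∘ₗ L.subtype) (e.toLinearMap ∘ₗ L.subtype)
  have hB : ∀ x y : Fin 8 → ℂ, B ⟨J x, x, rfl⟩ ⟨J y, y, rfl⟩ =
      x 0 * y 5 - x 1 * y 4 + x 2 * y 7 - x 3 * y 6 := by
    intro x y
    change symplecticPairing (e (J x)) (e (J y)) = _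
    rw [heJ, heJ, symplecticPairing_pairInclusion]
  refine ⟨L, B.toQuadraticMap, ?_, ?_, ?_⟩
  · rw [LinearMap.finrank_range_of_inj hJ]
    simp
  · rintro ⟨_, x, rfl⟩ h
    have h' : ∀ y : Fin 8 → ℂ, x 0 * y 5 - x 1 * y 4 + x 2 * y 7 - x 3 * y 6 +
        (y 0 * x 5 - y 1 * x 4 + y 2 * x 7 - y 3 * x 6) = 0 := by
      intro y
      rw [← hB, ← hB]
      simpa [QuadraticMap.polarBilin, LinearMap.BilinMap.polar_toQuadraticMap] using h ⟨J y, y, rfl⟩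
    have hx : x = 0 := by
      funext i
      fin_cases i
      -- The polar form pairs each coordinate of `x` with exactly one basis vector, up to sign.
      · simpa using h' (Pi.single 5 1)
      · simpa using h' (Pi.single 4 1)
      · simpa using h' (Pi.single 7 1)
      · simpa using h' (Pi.single 6 1)
      · simpa using h' (Pi.single 1 1)
      · simpa using h' (Pi.single 0 1)
      · simpa using h' (Pi.single 3 1)
      · simpa using h' (Pi.single 2 1)
    subst hx
    exact Subtype.ext (map_zero J)
  · rintro p ⟨_, x, rfl⟩ hp hq
    rw [LinearMap.BilinMap.toQuadraticMap_apply, hB] at hq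
    induction p with
    | h v hv =>
      rw [Projectivization.submodule_mk] at hp
      change ℂ ∙ v = ℂ ∙ J x at hp
      obtain ⟨c, hc⟩ := Submodule.mem_span_singleton.1
        (hp ▸ Submodule.mem_span_singleton_self v : v ∈ ℂ ∙ J x)
      rw [Set.mem_preimage, Projectivization.map_mk]
      refine hX _ _ (quadrics_eq_zero_of_bivector_eq_zero (fun i hi => ?_) ?_)
      · change e v i = 0
        rw [← hc, map_smul, heJ, Pi.smul_apply, pairInclusion_apply_of_le _ _ hi, smul_zero]
      · change symplecticPairing (e v) (e v) = 0
        rw [← hc, map_smul, heJ, map_smul, map_smul, LinearMap.smul_apply,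
          symplecticPairing_pairInclusion, hq, smul_zero, smul_zero]

/-- The image of the section by the hyperplane `p₂₃ + p₄₅ = 0` under the projection from the node
`b 0 ∧ b 1`, in coordinates. -/
def coordinateImage (b : Module.Basis (Fin 6) ℂ (Fin 6 → ℂ))
    (ω : ⋀[ℂ]^2 (Fin 6 → ℂ) →ₗ[ℂ] ℂ) : Set (ℙ ℂ (Fin 13 → ℂ)) :=
  {q | ∃ p ∈ hyperplaneSection ω, ∃ x : LinearMap.ker ω,
    p.submodule = ℂ ∙ (x : ⋀[ℂ]^2 (Fin 6 → ℂ)) ∧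
      q.submodule = ℂ ∙ nodeCoordinates b (x : ⋀[ℂ]^2 (Fin 6 → ℂ))}

variable {b : Module.Basis (Fin 6) ℂ (Fin 6 → ℂ)} {ω : ⋀[ℂ]^2 (Fin 6 → ℂ) →ₗ[ℂ] ℂ}

theorem quadrics_eq_zero_of_mem_cone (hω : ω = pluecker b 2 3 + pluecker b 4 5) {w : Fin 13 → ℂ}
    (hw : w ∈ cone (coordinateImage b ω)) (k : Fin 10) : quadrics w k = 0 := by
  obtain ⟨q, ⟨p, ⟨⟨y, z, hyz⟩, hp⟩, x, hpx, hq⟩, hwq⟩ := hw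
  have hyzω : wedge y z ∈ LinearMap.ker ω :=
    hp (hyz ▸ Submodule.mem_span_singleton_self _)
  obtain ⟨c, hc⟩ := Submodule.mem_span_singleton.1
    (show (x : ⋀[ℂ]^2 (Fin 6 → ℂ)) ∈ ℂ ∙ wedge y z from
      hyz ▸ hpx ▸ Submodule.mem_span_singleton_self _)
  rw [hq, Submodule.mem_span_singleton] at hwq
  obtain ⟨d, rfl⟩ := hwq
  rw [← hc, map_smul, smul_smul, quadrics_smul, quadrics_nodeCoordinates_wedge, mul_zero]
  rw [hω] at hyzω
  exact hyzω

/-- Every solution with `β ≠ 0` is an actual image point; only solutions with `β = 0` may require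
passing to the closure. -/
theorem bivectorLocus_subset_cone (hω : ω = pluecker b 2 3 + pluecker b 4 5) :
    bivectorLocus ⊆ cone (coordinateImage b ω) := by
  intro w hw
  obtain ⟨y, z, hyz, h⟩ := exists_wedge_of_mem_bivectorLocus b hw
  have hw0 : w ≠ 0 := by
    rintro rfl
    obtain ⟨i, -, hi⟩ := hw.2
    exact hi rfl
  have hne : wedge y z ≠ 0 := by
    intro h0
    rw [h0, map_zero] at hyz
    exact hw0 hyz.symm
  have hker : wedge y z ∈ LinearMap.ker ω := by
    rw [hω]
    exact h
  rw [mem_cone_iff hw0]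
  refine ⟨Projectivization.mk ℂ _ hne, ⟨⟨y, z, Projectivization.submodule_mk _ hne⟩, ?_⟩,
    ⟨wedge y z, hker⟩, Projectivization.submodule_mk _ hne, ?_⟩
  · rw [Projectivization.submodule_mk, Submodule.span_singleton_le_iff_mem]
    exact hker
  · rw [Projectivization.submodule_mk, hyz]

/-- Two projections from the same point differ by a change of coordinates. -/
theorem exists_linearEquiv_of_ker_eq {V : Type*} [AddCommGroup V] [Module ℂ V] {m : ℕ}
    {π ψ : V →ₗ[ℂ] (Fin m → ℂ)} (hπ : Function.Surjective π)
    (h : LinearMap.ker π = LinearMap.ker ψ) :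
    ∃ e : (Fin m → ℂ) ≃ₗ[ℂ] (Fin m → ℂ), ∀ x, e (π x) = ψ x := by
  obtain ⟨g, hg⟩ := LinearMap.exists_rightInverse_of_surjective π (LinearMap.range_eq_top.2 hπ)
  have hg' : ∀ z, π (g z) = z := fun z => LinearMap.congr_fun hg z
  have hinj : Function.Injective (ψ ∘ₗ g) := by
    rw [← LinearMap.ker_eq_bot, LinearMap.ker_eq_bot']
    intro z hz
    have : g z ∈ LinearMap.ker π := h ▸ hz
    rw [← hg' z]
    exact this
  refine ⟨LinearEquiv.ofInjectiveEndo (ψ ∘ₗ g) hinj, fun x => ?_⟩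
  have : g (π x) - x ∈ LinearMap.ker ψ := by
    rw [← h, LinearMap.mem_ker, map_sub, hg', sub_self]
  rw [LinearMap.mem_ker, map_sub, sub_eq_zero] at this
  exact this

theorem projectedSection_eq_preimage {π : LinearMap.ker ω →ₗ[ℂ] (Fin 13 → ℂ)}
    (e : (Fin 13 → ℂ) ≃ₗ[ℂ] (Fin 13 → ℂ)) (he : ∀ x, e (π x) = nodeCoordinates b x) :
    projectedSection ω π = Projectivization.map e.toLinearMap e.injective ⁻¹'
      zariskiClosure (coordinateImage b ω) := by
  rw [← zariskiClosure_preimage, projectedSection]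
  congr 1
  ext q
  induction q with
  | h v hv =>
    refine exists_congr fun p => and_congr_right fun _ => exists_congr fun x =>
      and_congr_right fun _ => ?_
    rw [Projectivization.map_mk, Projectivization.submodule_mk, Projectivization.submodule_mk, ← he]
    have key : ∀ z : Fin 13 → ℂ, (ℂ ∙ z).map e.toLinearMap = ℂ ∙ e z := fun z => by
      rw [Submodule.map_span, Set.image_singleton]
      rfl
    change _ ↔ ℂ ∙ e v = ℂ ∙ e (π x)
    rw [← key, ← key]
    exact (Submodule.map_injective_of_injective e.injective).eq_iff.symm

end NodalSection

end NodalProjection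

end

/-! ### The theorem for an arbitrary projection from the node -/

theorem mainTheorem1
    (ω : ⋀[ℂ]^2 (Fin 6 → ℂ) →ₗ[ℂ] ℂ)
    (o : Projectivization ℂ (⋀[ℂ]^2 (Fin 6 → ℂ)))
    (ho : NodalProjection.IsNode ω o)
    (π : LinearMap.ker ω →ₗ[ℂ] (Fin 13 → ℂ))
    (hπ : Function.Surjective π)
    (hker : (LinearMap.ker π).map (LinearMap.ker ω).subtype = o.submodule) :
    NodalProjection.IsLinearSectionOf (NodalProjection.projectedSection ω π)
        NodalProjection.spinorTenfold ∧
      NodalProjection.ContainsSmoothQuadric 6 (NodalProjection.projectedSection ω π) := by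
  obtain ⟨b, hob, hb⟩ := ho.exists_basis
  have hω := NodalProjection.eq_pluecker_add_pluecker b hb
  -- Both `π` and the Plücker coordinates have the line of the node as kernel on `ker ω`, so they
  -- differ by a linear automorphism of `ℂ¹³`.
  have hkerψ : LinearMap.ker π =
      LinearMap.ker (NodalProjection.nodeCoordinates b ∘ₗ (LinearMap.ker ω).subtype) := by
    ext x
    have hx : NodalProjection.pluecker b 2 3 (x : ⋀[ℂ]^2 (Fin 6 → ℂ)) +
        NodalProjection.pluecker b 4 5 (x : ⋀[ℂ]^2 (Fin 6 → ℂ)) = 0 :=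
      (LinearMap.congr_fun hω _).symm.trans x.2
    rw [LinearMap.mem_ker (f := NodalProjection.nodeCoordinates b ∘ₗ _), LinearMap.comp_apply,
      Submodule.subtype_apply, NodalProjection.nodeCoordinates_eq_zero_iff b hx, ← hob, ← hker]
    constructor
    · exact fun h => ⟨x, h, rfl⟩
    · rintro ⟨y, hy, hyx⟩
      rwa [← Subtype.ext hyx]
  obtain ⟨e, he⟩ := NodalProjection.exists_linearEquiv_of_ker_eq
    (V := LinearMap.ker ω) hπ hkerψ
  rw [NodalProjection.projectedSection_eq_preimage e he]
  have hZ := NodalProjection.bivectorLocus_subset_cone hω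
  exact ⟨(NodalProjection.isLinearSectionOf_zariskiClosure hZ fun w hw =>
      NodalProjection.quadrics_eq_zero_of_mem_cone hω hw).preimage e,
    NodalProjection.containsSmoothQuadric_preimage e fun w hw =>
      NodalProjection.mk_mem_zariskiClosure_of_quadrics_eq_zero hZ hw⟩
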